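/- **Setting.** Let $\pi:X\to B$ be a Lagrangian torus bundle with $\dim_{\mathbb R}B=n$, given with action-angle coordinates $(r,\theta):\pi^{-1}(U)\cong r(U)\times(\mathbb R/\mathbb Z)^n$ over open sets $U$ covering $B$, in which $\omega=\sum_i d\theta_i\wedge dr_i$. Assume that the transitions are $r'=Ar+c$, $\theta'=A^{-T}\theta+t$ with $A\in SL(n,\mathbb Z)$, $c\in\mathbb R^n$, $t\in(\mathbb R/\mathbb Z)^n$ locally constant. Let $\check\pi:\check X=TB/\Lambda\to B$ be the dual torus bundle, where $\Lambda\subset TB$ is the lattice bundle generated by the $\partial/\partial r_i$. Let $\check\theta_i$ be its fibre coordinates and $z_i=\check\theta_i+\mathbf i r_i$ its complex coordinates. Let $\Omega_B^*(X,\mathbb C)$ and $\Omega_B^*(\check X,\mathbb C)$ be the spaces of smooth complex-valued forms (of all degrees) whose coefficients in these coordinates depend only on $r$. Let $\Omega_B^{p,q}(\check X)$ be the forms in $\Omega_B^*(\check X,\mathbb C)$ that are locally $\sum_{|I|=p,|J|=q}a_{IJ}(r)\,dz_I\wedge d\bar z_J$, and $\Omega_B^{(a,b)}(X)$ the forms in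 $\Omega_B^*(X,\mathbb C)$ that are locally $\sum_{|I|=a,|J|=b}a_{IJ}(r)\,d\theta_I\wedge dr_J$ (zero if $a<0$). Let $d^\Lambda=d\Lambda-\Lambda d$ on $X$, where $\Lambda=\sum_i\iota_{\partial/\partial r_i}\iota_{\partial/\partial\theta_i}$ is the dual Lefschetz operator of $\omega$. Let $\mathcal P$ be the polarization switch on $\check X$, i.e. the algebra homomorphism with $dz_i\mapsto d\check\theta_i$, $d\bar z_i\mapsto dr_i$. Let $\mathbf F=2\mathbf i\sum_i d\check\theta_i\wedge d\theta_i$ on $X\times_B\check X$. The Fourier-Mukai transforms are $$\mathrm{FT}\,\check\phi=\pi_*\Big(\check\pi^*(\mathcal P\check\phi)\wedge\exp\tfrac{\mathbf F}{2\mathbf i}\Big),\qquad \mathrm{FT}\,\phi=\mathcal P^{-1}\check\pi_*\Big(\pi^*\phi\wedge\exp\tfrac{-\mathbf F}{2\mathbf i}\Big),$$ for $\check\phi\in\Omega_B^*(\check X,\mathbb C)$ and $\phi\in\Omega_B^*(X,\mathbb C)$. Here $\pi_*$ and $\check\pi_*$ are integration along the torus fibres of $X\times_B\check X\to X$ and $X\times_B\check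 X\to\check X$, with $\pi_*(d\check\theta_1\wedge\dots\wedge d\check\theta_n\wedge\alpha)=\int\alpha$ when $\alpha$ has no $d\check\theta_i$, and likewise $\check\pi_*$ with $d\theta_1\wedge\dots\wedge d\theta_n$. **Theorem 4.3.** $\big(\Omega_B^*(\check X,\mathbb C),\bar\partial,\partial\big)$, with pieces $\Omega_B^{p,q}(\check X)$, and $$\Big(\Omega_B^*(X,\mathbb C),\ \tfrac{(-1)^n\mathbf i}{2}\,d,\ \tfrac{(-1)^n\mathbf i}{2}\,d^\Lambda\Big),$$ with pieces $\Omega_B^{(n-p,q)}(X)$, are double complexes: each space is the direct sum of its pieces, the two operators have bidegrees $(0,1)$ and $(1,0)$ in $(p,q)$, have square zero, and anticommute. Both Fourier-Mukai transforms, from $\check X$ to $X$ and from $X$ to $\check X$, are isomorphisms between these double complexes: they are $\mathbb C$-linear bijections between $\Omega_B^*(\check X,\mathbb C)$ and $\Omega_B^*(X,\mathbb C)$, match $\Omega_B^{p,q}(\check X)$ with $\Omega_B^{(n-p,q)}(X)$ for all $p,q\ge 0$, and transform $\bar\partial$ into $\tfrac{(-1)^n\mathbf i}{2}\,d$ and $\partial$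 into $\tfrac{(-1)^n\mathbf i}{2}\,d^\Lambda$ and vice versa. -/

import Mathlib

open scoped Topology Manifold ContDiff

noncomputable section

namespace SemiFlat

/-! ### Complex exterior algebras with a coordinate coframe, and calculus in them -/

/-- The complex exterior algebra on a coframe `(d x_s)` indexed by a finite type `σ`.  If `x_s` are
local coordinates of a manifold, this is the fibre of `Λ^*(T^* ⊗ ℂ)` (all degrees together), and
the multiplication is the wedge product. -/
abbrev Ext (σ : Type) : Type := ExteriorAlgebra ℂ (σ → ℂ)

section Algebra
variable {σ τ : Type} [Fintype σ] [DecidableEq σ]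

instance finite_ext : Module.Finite ℂ (Ext σ) := by
  have hz : ∀ k, Fintype.card σ < k → (⋀[ℂ]^k (σ → ℂ)) = ⊥ := by
    intro k hk
    have h0 : Module.finrank ℂ (⋀[ℂ]^k (σ → ℂ)) = 0 := by
      rw [exteriorPower.finrank_eq]
      simpa using Nat.choose_eq_zero_of_lt hk
    exact Submodule.finrank_eq_zero.mp h0
  have htop : (⨆ k, ⋀[ℂ]^k (σ → ℂ)) = ⊤ :=
    (DirectSum.Decomposition.isInternal (fun k : ℕ => ⋀[ℂ]^k (σ → ℂ))).submodule_iSup_eq_top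
  have hfin : (⨆ k : Fin (Fintype.card σ + 1), ⋀[ℂ]^(k : ℕ) (σ → ℂ)) = ⊤ := by
    rw [eq_top_iff, ← htop]
    refine iSup_le fun k => ?_
    by_cases hk : Fintype.card σ < k
    · rw [hz k hk]
      exact bot_le
    · exact le_iSup (fun k : Fin (Fintype.card σ + 1) => ⋀[ℂ]^(k : ℕ) (σ → ℂ))
        ⟨k, by omega⟩
  refine ⟨?_⟩
  rw [← hfin]
  refine Submodule.fg_iSup _ fun k => ?_
  exact Module.Finite.iff_fg.mp inferInstance

/-- The coordinate one-form `d x_s`. -/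
def dx (s : σ) : Ext σ := ExteriorAlgebra.ι ℂ (Pi.single s 1)

/-- Interior product with the coordinate vector field `∂/∂x_s`. -/
def contr (s : σ) : Ext σ →ₗ[ℂ] Ext σ :=
  CliffordAlgebra.contractLeft (Q := (0 : QuadraticForm ℂ (σ → ℂ)))
    (LinearMap.proj s : (σ → ℂ) →ₗ[ℂ] ℂ)

/-- The algebra homomorphism with `d x_s ↦ ∑ t, c s t • d x_t`. -/
def subst [Fintype τ] [DecidableEq τ] (c : σ → τ → ℂ) : Ext σ →ₐ[ℂ] Ext τ :=
  ExteriorAlgebra.map ((Pi.basisFun ℂ σ).constr ℂ c)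

/-- Apply a scalar operator `L` to every component of a function with values in the
finite-dimensional space `Ext σ`. -/
def componentwise {M : Type*} (L : (M → ℂ) → ℂ) (f : M → Ext σ) : Ext σ :=
  ∑ j, L (fun m => (Module.finBasis ℂ (Ext σ)).repr (f m) j) • Module.finBasis ℂ (Ext σ) j

/-- The partial derivative `∂f/∂x_s` at `p` of an `Ext σ`-valued function of real variables. -/
def pderiv {κ : Type} [Fintype κ] [DecidableEq κ] (s : κ) (f : (κ → ℝ) → Ext σ) (p : κ → ℝ) :
    Ext σ :=
  componentwise (fun g => fderiv ℝ g p (Pi.single s 1)) f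

/-- The integral over the unit cube `[0,1]^n`, a fundamental domain of `ℝ^n/ℤ^n`. -/
def cubeIntegral {n : ℕ} (f : (Fin n → ℝ) → Ext σ) : Ext σ :=
  componentwise (fun g => ∫ t in Set.Icc (0 : Fin n → ℝ) 1, g t) f

/-- Smoothness of an `Ext σ`-valued function on a set. -/
def SmoothOn {n : ℕ} (f : (Fin n → ℝ) → Ext σ) (U : Set (Fin n → ℝ)) : Prop :=
  ∀ l : Module.Dual ℂ (Ext σ), ContDiffOn ℝ ∞ (fun r => l (f r)) U

end Algebra

/-! ### Coframes on `X`, on the mirror, and on their fibre product -/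

/-- Coordinates on a torus bundle over an `n`-dimensional base: `inl i` stands for the base
coordinate `r_i`, `inr i` for the fibre coordinate (`θ_i` on `X`, `θ̌_i` on the mirror). -/
abbrev Ix (n : ℕ) : Type := Fin n ⊕ Fin n

/-- Coordinates on the fibre product: `inl i` for `r_i`, `inr (inl i)` for `θ_i`,
`inr (inr i)` for `θ̌_i`. -/
abbrev Ix₂ (n : ℕ) : Type := Fin n ⊕ (Fin n ⊕ Fin n)

variable {n : ℕ}

/-- `d r_i`, on `X` and on the mirror. -/
def dr (i : Fin n) : Ext (Ix n) := dx (Sum.inl i)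

/-- `d θ_i` on `X`, and `d θ̌_i` on the mirror. -/
def dth (i : Fin n) : Ext (Ix n) := dx (Sum.inr i)

/-- `d z_i = d θ̌_i + 𝐢 d r_i`. -/
def dz (i : Fin n) : Ext (Ix n) := dth i + Complex.I • dr i

/-- The conjugate `d z̄_i = d θ̌_i - 𝐢 d r_i`. -/
def dzbar (i : Fin n) : Ext (Ix n) := dth i - Complex.I • dr i

/-- Polarization switch: the algebra homomorphism with `d z_i ↦ d θ̌_i`, `d z̄_i ↦ d r_i`. As
`d r_i = (d z_i - d z̄_i) / 2𝐢` and `d θ̌_i = (d z_i + d z̄_i) / 2`, it is given by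
`d r_i ↦ (d θ̌_i - d r_i) / 2𝐢` and `d θ̌_i ↦ (d θ̌_i + d r_i) / 2`. -/
def polSwitch : Ext (Ix n) →ₐ[ℂ] Ext (Ix n) :=
  subst fun s => Sum.elim
    (fun i => (2 * Complex.I)⁻¹ • (Pi.single (Sum.inr i) 1 - Pi.single (Sum.inl i) 1))
    (fun i => (2 : ℂ)⁻¹ • (Pi.single (Sum.inr i) 1 + Pi.single (Sum.inl i) 1)) s

/-- Inverse polarization switch: `d θ̌_i ↦ d z_i`, `d r_i ↦ d z̄_i`. -/
def polSwitchInv : Ext (Ix n) →ₐ[ℂ] Ext (Ix n) :=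
  subst fun s => Sum.elim
    (fun i => Pi.single (Sum.inr i) 1 - Complex.I • Pi.single (Sum.inl i) 1)
    (fun i => Pi.single (Sum.inr i) 1 + Complex.I • Pi.single (Sum.inl i) 1) s

/-- Pointwise pull-back of forms from `X` to the fibre product. -/
def pullX : Ext (Ix n) →ₐ[ℂ] Ext (Ix₂ n) :=
  subst fun s => Sum.elim (fun i => Pi.single (Sum.inl i) 1)
    (fun i => Pi.single (Sum.inr (Sum.inl i)) 1) s

/-- Pointwise pull-back of forms from the mirror to the fibre product. -/
def pullDual : Ext (Ix n) →ₐ[ℂ] Ext (Ix₂ n) :=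
  subst fun s => Sum.elim (fun i => Pi.single (Sum.inl i) 1)
    (fun i => Pi.single (Sum.inr (Sum.inr i)) 1) s

/-- The curvature `2𝐢 ∑ d θ̌_i ∧ d θ_i` of the universal connection. -/
def curvature : Ext (Ix₂ n) :=
  (2 * Complex.I) • ∑ i : Fin n, dx (Sum.inr (Sum.inr i)) * dx (Sum.inr (Sum.inl i))

/-- The integrand of fibre integration along the `θ̌`-directions: it sends
`d θ̌_1 ∧ … ∧ d θ̌_n ∧ α` to `α` for `α` free of `d θ̌`'s, and kills the monomials which do not
contain all the `d θ̌_i`.  (Contract with `∂/∂θ̌_1` first, then with `∂/∂θ̌_2`, and so on.) -/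
def stripDual (ψ : Ext (Ix₂ n)) : Ext (Ix n) :=
  subst (fun s => Sum.elim (fun i => Pi.single (Sum.inl i) 1)
      (Sum.elim (fun i => Pi.single (Sum.inr i) 1) fun _ => 0) s)
    ((List.finRange n).foldl (fun χ i => contr (Sum.inr (Sum.inr i)) χ) ψ)

/-- The integrand of fibre integration along the `θ`-directions: it sends
`d θ_1 ∧ … ∧ d θ_n ∧ α` to `α` for `α` free of `d θ`'s, and kills the monomials which do not
contain all the `d θ_i`. -/
def stripX (ψ : Ext (Ix₂ n)) : Ext (Ix n) :=
  subst (fun s => Sum.elim (fun i => Pi.single (Sum.inl i) 1)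
      (Sum.elim (fun _ => 0) fun i => Pi.single (Sum.inr i) 1) s)
    ((List.finRange n).foldl (fun χ i => contr (Sum.inr (Sum.inl i)) χ) ψ)

/-- The span of the products `u_{i_1} ∧ … ∧ u_{i_p} ∧ v_{j_1} ∧ … ∧ v_{j_q}`. -/
def biSpan (u v : Fin n → Ext (Ix n)) (p q : ℕ) : Submodule ℂ (Ext (Ix n)) :=
  Submodule.span ℂ (Set.range u) ^ p * Submodule.span ℂ (Set.range v) ^ q

/-- Exterior derivative in local coordinates, `d = ∑ d x_s ∧ ∂/∂x_s`. -/
def extD (f : (Ix n → ℝ) → Ext (Ix n)) (p : Ix n → ℝ) : Ext (Ix n) :=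
  ∑ s, dx s * pderiv s f p

/-- `∂ = ∑ d z_i ∧ ∂/∂z_i` in local coordinates, where `∂/∂z_i = (∂/∂θ̌_i - 𝐢 ∂/∂r_i) / 2`. -/
def dolb (f : (Ix n → ℝ) → Ext (Ix n)) (p : Ix n → ℝ) : Ext (Ix n) :=
  ∑ i, dz i * ((2 : ℂ)⁻¹ • (pderiv (Sum.inr i) f p - Complex.I • pderiv (Sum.inl i) f p))

/-- `∂̄ = ∑ d z̄_i ∧ ∂/∂z̄_i` in local coordinates, where
`∂/∂z̄_i = (∂/∂θ̌_i + 𝐢 ∂/∂r_i) / 2`. -/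
def dolbBar (f : (Ix n → ℝ) → Ext (Ix n)) (p : Ix n → ℝ) : Ext (Ix n) :=
  ∑ i, dzbar i * ((2 : ℂ)⁻¹ • (pderiv (Sum.inr i) f p + Complex.I • pderiv (Sum.inl i) f p))

/-- The matrix `w(∂/∂x_s, ∂/∂x_t)` of a two-form `w`. -/
def twoFormMatrix (w : Ext (Ix n)) : Matrix (Ix n) (Ix n) ℂ :=
  Matrix.of fun s t => ExteriorAlgebra.algebraMapInv (contr t (contr s w))

/-! ### Semi-flat Lagrangian torus bundles -/

variable {B : Type*} {X : Type*} [TopologicalSpace B] [ChartedSpace (Fin n → ℝ) B]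
  [TopologicalSpace X]

variable (n B X) in
/-- A Lagrangian torus bundle `π : X → B` with a system of action-angle coordinates.  The charts
`r = (r_1, …, r_n)` in the atlas of `B` are the action coordinate systems.  Each comes with
action-angle coordinates `(r, θ) : π⁻¹(U) ≅ r(U) × (ℝ/ℤ)^n`, that is `π⁻¹(U) ≅ T^*U/Λ^*` with
`Λ^*` generated by `d r_1, …, d r_n`.  The transitions are `r' = A r + c` with
`A ∈ SL(n,ℤ)`, and `θ' = A^{-T} θ + t`.  All of `A, c, t` are locally constant; for `t` this says
that the two-forms `∑ d θ̌_i ∧ d θ_i` (the curvature of the universal connection) agree on overlaps.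
The smooth structure of `X` is that of these coordinates, and its symplectic form is
`ω = ∑ d θ_i ∧ d r_i`, which the transitions preserve. -/
structure LagrangianTorusBundle where
  proj : X → B
  coord : atlas (Fin n → ℝ) B → OpenPartialHomeomorph X ((Fin n → ℝ) × (Fin n → UnitAddCircle))
  coord_source : ∀ e, (coord e).source = proj ⁻¹' e.1.source
  coord_target : ∀ e, (coord e).target = e.1.target ×ˢ Set.univ
  coord_fst : ∀ e, ∀ x ∈ (coord e).source, (coord e x).1 = e.1 (proj x)
  transition : ∀ e e' : atlas (Fin n → ℝ) B, ∀ b ∈ e.1.source ∩ e'.1.source,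
    ∃ (A : Matrix.SpecialLinearGroup (Fin n) ℤ) (c : Fin n → ℝ) (t : Fin n → UnitAddCircle),
      ∀ᶠ b' in 𝓝 b,
        (∀ i, e'.1 b' i = ∑ j, (A.1 i j : ℝ) * e.1 b' j + c i) ∧
        ∀ x, proj x = b' → ∀ i, (coord e' x).2 i = ∑ j, (A⁻¹).1 j i • (coord e x).2 j + t i

/-- The preferred action coordinate system at `b`; its coordinate vector fields `∂/∂r_i` are the
standard basis of `TangentSpace 𝓘(ℝ, Fin n → ℝ) b`. -/
def chart₀ (b : B) : atlas (Fin n → ℝ) B := ⟨chartAt (Fin n → ℝ) b, chart_mem_atlas _ b⟩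

/-- The differential `(d r_1, …, d r_n) : T_b B → ℝ^n` of the action coordinates `e`. -/
def diffAt (e : atlas (Fin n → ℝ) B) (b : B) :
    TangentSpace 𝓘(ℝ, Fin n → ℝ) b →L[ℝ] (Fin n → ℝ) :=
  mfderiv 𝓘(ℝ, Fin n → ℝ) 𝓘(ℝ, Fin n → ℝ) e.1 b

/-- The tangent vector `∑ t_i ∂/∂r_i` at `b`, for the action coordinates `e`. -/
def tangentVec (e : atlas (Fin n → ℝ) B) (b : B) (t : Fin n → ℝ) :
    TangentSpace 𝓘(ℝ, Fin n → ℝ) b :=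
  (diffAt e b).inverse t

/-- The Jacobian matrix at `b` of the action coordinates `e` with respect to the preferred ones. -/
def jac (e : atlas (Fin n → ℝ) B) (b : B) : Matrix (Fin n) (Fin n) ℝ :=
  LinearMap.toMatrix' (diffAt e b : (Fin n → ℝ) →L[ℝ] (Fin n → ℝ)).toLinearMap

/-! ### The dual torus bundle -/

variable (n) in
/-- The lattice `Λ_b ⊂ T_b B` generated by the `∂/∂r_i`, for action coordinates around `b`. -/
def lattice (b : B) : AddSubgroup (TangentSpace 𝓘(ℝ, Fin n → ℝ) b) :=
  AddSubgroup.closure {v | ∃ e : atlas (Fin n → ℝ) B, b ∈ e.1.source ∧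
    ∃ i, v = tangentVec e b (Pi.single i 1)}

variable (n B) in
/-- The dual torus bundle `X̌ = TB/Λ`.  Its fibre `T_b B/Λ_b = Hom(Λ^*_b, ℝ/ℤ)` is the torus of
flat `U(1)`-connections on `F_b = T^*_b B/Λ^*_b`, whose first homology is `Λ^*_b`. -/
def Mirror : Type _ := Σ b : B, TangentSpace 𝓘(ℝ, Fin n → ℝ) b ⧸ lattice n b

/-- The projection `π̌ : X̌ → B`. -/
def mirrorProj (y : Mirror n B) : B := y.1

/-- The point of `X̌` over `b` with fibre coordinates `θ̌ = t` in the action coordinates `e`. -/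
def mirrorPt (e : atlas (Fin n → ℝ) B) (b : B) (t : Fin n → ℝ) : Mirror n B :=
  ⟨b, QuotientAddGroup.mk (tangentVec e b t)⟩

/-- Some fibre coordinates `θ̌ ∈ ℝ^n` of a point of `X̌` in the action coordinates `e`. -/
def mirrorFib (e : atlas (Fin n → ℝ) B) (y : Mirror n B) : Fin n → ℝ :=
  diffAt e y.1 (Quotient.out y.2)

/-! ### Differential forms

A form on `X` (or `X̌`) is a section of `Λ^*(T^* ⊗ ℂ)`.  As for Mathlib's tangent bundle, its value
at a point over `b` is recorded in the coframe of the preferred coordinates `chart₀ b`. -/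

/-- Rewriting, at points of `X` over `b`, a form in the coframe `(d r, d θ)` of the coordinates `e`:
the preferred coframe is `d r⁰ = J⁻¹ d r`, `d θ⁰ = Jᵀ d θ`, where `J = jac e b`. -/
def toFrameX (e : atlas (Fin n → ℝ) B) (b : B) : Ext (Ix n) →ₐ[ℂ] Ext (Ix n) :=
  subst fun s => Sum.elim
    (fun i => ∑ j, (((jac e b)⁻¹ i j : ℝ) : ℂ) • Pi.single (Sum.inl j) 1)
    (fun i => ∑ j, ((jac e b j i : ℝ) : ℂ) • Pi.single (Sum.inr j) 1) s

/-- Rewriting, at points of `X̌` over `b`, a form in the coframe `(d r, d θ̌)` of the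
coordinates `e`: the preferred coframe is `d r⁰ = J⁻¹ d r`, `d θ̌⁰ = J⁻¹ d θ̌`. -/
def toFrameMirror (e : atlas (Fin n → ℝ) B) (b : B) : Ext (Ix n) →ₐ[ℂ] Ext (Ix n) :=
  subst fun s => Sum.elim
    (fun i => ∑ j, (((jac e b)⁻¹ i j : ℝ) : ℂ) • Pi.single (Sum.inl j) 1)
    (fun i => ∑ j, (((jac e b)⁻¹ i j : ℝ) : ℂ) • Pi.single (Sum.inr j) 1) s

/-! #### Forms on the mirror -/

/-- The expression in the coordinates `e` of a form on `X̌`, as a function of `(r, θ̌)`. -/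
def localMirror (e : atlas (Fin n → ℝ) B) (φ : Mirror n B → Ext (Ix n)) (p : Ix n → ℝ) :
    Ext (Ix n) :=
  toFrameMirror e (e.1.symm (p ∘ Sum.inl)) (φ (mirrorPt e (e.1.symm (p ∘ Sum.inl)) (p ∘ Sum.inr)))

/-- Apply a differential operator, given in local coordinates, to a form on `X̌`. -/
def mirrorOp (D : ((Ix n → ℝ) → Ext (Ix n)) → (Ix n → ℝ) → Ext (Ix n))
    (φ : Mirror n B → Ext (Ix n)) (y : Mirror n B) : Ext (Ix n) :=
  D (localMirror (chart₀ y.1) φ) (Sum.elim ((chart₀ (n := n) y.1).1 y.1) (mirrorFib (chart₀ y.1) y))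

/-- The Dolbeault operator `∂` on `X̌`. -/
def del (φ : Mirror n B → Ext (Ix n)) : Mirror n B → Ext (Ix n) := mirrorOp dolb φ

/-- The Dolbeault operator `∂̄` on `X̌`. -/
def delBar (φ : Mirror n B → Ext (Ix n)) : Mirror n B → Ext (Ix n) := mirrorOp dolbBar φ

variable (n B) in
/-- `Ω_B^*(X̌, ℂ)`: the smooth forms which in all action coordinates have coefficients depending
only on `r`. -/
def OmegaMirror : Submodule ℂ (Mirror n B → Ext (Ix n)) where
  carrier := {φ | ∀ e : atlas (Fin n → ℝ) B, ∃ a : (Fin n → ℝ) → Ext (Ix n),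
    SmoothOn a e.1.target ∧
      ∀ b ∈ e.1.source, ∀ t, toFrameMirror e b (φ (mirrorPt e b t)) = a (e.1 b)}
  add_mem' := by
    intro φ ψ hφ hψ e
    obtain ⟨a, ha, ha'⟩ := hφ e
    obtain ⟨c, hc, hc'⟩ := hψ e
    refine ⟨a + c, fun l => ?_, fun b hb t => ?_⟩
    · simpa using (ha l).add (hc l)
    · simp [ha' b hb t, hc' b hb t]
  zero_mem' := fun e => ⟨0, fun l => by simpa using contDiffOn_const, fun b hb t => by simp⟩
  smul_mem' := by
    intro c φ hφ e
    obtain ⟨a, ha, ha'⟩ := hφ e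
    refine ⟨c • a, fun l => ?_, fun b hb t => ?_⟩
    · simpa using (contDiffOn_const (c := c)).mul (ha l)
    · simp [ha' b hb t]

variable (n B) in
/-- `Ω_B^{p,q}(X̌)`. -/
def OmegaMirrorPQ (p q : ℕ) : Submodule ℂ (Mirror n B → Ext (Ix n)) :=
  OmegaMirror n B ⊓ Submodule.pi Set.univ fun _ => biSpan dz dzbar p q

/-! #### Forms on the Lagrangian torus bundle -/

namespace LagrangianTorusBundle

variable (S : LagrangianTorusBundle n B X)

/-- The point of `X` over `b` with fibre coordinates `θ = t` in the coordinates `e`. -/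
def pt (e : atlas (Fin n → ℝ) B) (b : B) (t : Fin n → ℝ) : X :=
  (S.coord e).symm (e.1 b, fun i => (t i : UnitAddCircle))

/-- Some fibre coordinates `θ ∈ ℝ^n` of a point of `X` in the coordinates `e`. -/
def fib (e : atlas (Fin n → ℝ) B) (x : X) : Fin n → ℝ := fun i => Quotient.out ((S.coord e x).2 i)

theorem proj_pt (e : atlas (Fin n → ℝ) B) (b : B) (hb : b ∈ e.1.source) (t : Fin n → ℝ) :
    S.proj (S.pt e b t) = b := by
  have h : (e.1 b, fun i => (t i : UnitAddCircle)) ∈ (S.coord e).target := by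
    rw [S.coord_target]
    exact ⟨e.1.map_source hb, trivial⟩
  have hx : S.pt e b t ∈ (S.coord e).source := (S.coord e).map_target h
  have h1 := S.coord_fst e _ hx
  have h2 : S.coord e (S.pt e b t) = (e.1 b, fun i => (t i : UnitAddCircle)) :=
    (S.coord e).right_inv h
  rw [h2] at h1
  rw [S.coord_source] at hx
  exact (e.1.injOn hb hx h1).symm

/-- The expression in the coordinates `e` of a form on `X`, as a function of `(r, θ)`. -/
def localForm (e : atlas (Fin n → ℝ) B) (φ : X → Ext (Ix n)) (p : Ix n → ℝ) : Ext (Ix n) :=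
  toFrameX e (e.1.symm (p ∘ Sum.inl)) (φ (S.pt e (e.1.symm (p ∘ Sum.inl)) (p ∘ Sum.inr)))

/-- The exterior derivative on `X`. -/
def d (φ : X → Ext (Ix n)) (x : X) : Ext (Ix n) :=
  extD (S.localForm (chart₀ (S.proj x)) φ)
    (Sum.elim ((chart₀ (n := n) (S.proj x)).1 (S.proj x)) (S.fib (chart₀ (S.proj x)) x))

/-- The symplectic form `ω = ∑ d θ_i ∧ d r_i` of `X`. -/
def symplecticForm (_S : LagrangianTorusBundle n B X) : X → Ext (Ix n) :=
  fun _ => ∑ i, dth i * dr i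

/-- The dual Lefschetz operator `Λ φ = ½ ∑ (ω⁻¹)^{st} ι_s ι_t φ`. -/
def dualLefschetz (φ : X → Ext (Ix n)) (x : X) : Ext (Ix n) :=
  (2 : ℂ)⁻¹ • ∑ s, ∑ t, (twoFormMatrix (S.symplecticForm x))⁻¹ s t • contr s (contr t (φ x))

/-- The symplectic adjoint `d^Λ = d Λ - Λ d`. -/
def dLambda (φ : X → Ext (Ix n)) : X → Ext (Ix n) :=
  S.d (S.dualLefschetz φ) - S.dualLefschetz (S.d φ)

/-- `Ω_B^*(X, ℂ)`: the smooth forms which in all action-angle coordinates have coefficients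
depending only on `r`. -/
def Omega : Submodule ℂ (X → Ext (Ix n)) where
  carrier := {φ | ∀ e : atlas (Fin n → ℝ) B, ∃ a : (Fin n → ℝ) → Ext (Ix n),
    SmoothOn a e.1.target ∧
      ∀ b ∈ e.1.source, ∀ t, toFrameX e b (φ (S.pt e b t)) = a (e.1 b)}
  add_mem' := by
    intro φ ψ hφ hψ e
    obtain ⟨a, ha, ha'⟩ := hφ e
    obtain ⟨c, hc, hc'⟩ := hψ e
    refine ⟨a + c, fun l => ?_, fun b hb t => ?_⟩
    · simpa using (ha l).add (hc l)
    · simp [ha' b hb t, hc' b hb t]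
  zero_mem' := fun e => ⟨0, fun l => by simpa using contDiffOn_const, fun b hb t => by simp⟩
  smul_mem' := by
    intro c φ hφ e
    obtain ⟨a, ha, ha'⟩ := hφ e
    refine ⟨c • a, fun l => ?_, fun b hb t => ?_⟩
    · simpa using (contDiffOn_const (c := c)).mul (ha l)
    · simp [ha' b hb t]

/-- The piece of bidegree `(p,q)` of the double complex on `X`: the forms in `Ω_B^*(X, ℂ)` with
`n - p` fibre directions `d θ` and `q` base directions `d r` (none if `p > n`). -/
def OmegaPQ (p q : ℕ) : Submodule ℂ (X → Ext (Ix n)) :=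
  if p ≤ n then S.Omega ⊓ Submodule.pi Set.univ fun _ => biSpan dth dr (n - p) q else ⊥

/-! #### Fourier-Mukai transform -/

/-- The fibre product `X ×_B X̌`. -/
def FibProd : Type _ := {w : X × Mirror n B // S.proj w.1 = mirrorProj w.2}

/-- Push-forward of forms on `X ×_B X̌` along `X ×_B X̌ → X`: integration over the torus fibres
of `X̌`. -/
def pushX (ψ : S.FibProd → Ext (Ix₂ n)) (x : X) : Ext (Ix n) :=
  cubeIntegral fun t => stripDual (ψ ⟨(x, mirrorPt (chart₀ (S.proj x)) (S.proj x) t), rfl⟩)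

/-- Push-forward of forms on `X ×_B X̌` along `X ×_B X̌ → X̌`: integration over the torus fibres
of `X`. -/
def pushMirror (ψ : S.FibProd → Ext (Ix₂ n)) (y : Mirror n B) : Ext (Ix n) :=
  cubeIntegral fun t => stripX (ψ ⟨(S.pt (chart₀ (mirrorProj y)) (mirrorProj y) t, y),
    S.proj_pt _ _ (mem_chart_source _ _) t⟩)

/-- Fourier-Mukai transform from `X̌` to `X`:
`FT φ = π_* (π̌^*(𝒫 φ) ∧ exp (F / 2𝐢))`. -/
def FT (φ : Mirror n B → Ext (Ix n)) : X → Ext (Ix n) :=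
  S.pushX fun w =>
    pullDual (polSwitch (φ w.1.2)) * IsNilpotent.exp ((2 * Complex.I)⁻¹ • curvature)

/-- Fourier-Mukai transform from `X` to `X̌`:
`FT φ = 𝒫⁻¹ π̌_* (π^*φ ∧ exp (-F / 2𝐢))`. -/
def FTinv (φ : X → Ext (Ix n)) : Mirror n B → Ext (Ix n) := fun y =>
  polSwitchInv (S.pushMirror
    (fun w => pullX (φ w.1.1) * IsNilpotent.exp (-(2 * Complex.I)⁻¹ • curvature)) y)

end LagrangianTorusBundle

/-! ### Double complexes -/

/-- `(Ω, D₁, D₂)` is a double complex of complex vector spaces with pieces `W p q`: it is the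
direct sum of these, `D₁` and `D₂` are linear on `Ω` of bidegrees `(1,0)` and `(0,1)`, they square
to zero, and they anticommute. -/
structure IsDoubleComplex {V : Type*} [AddCommGroup V] [Module ℂ V] (Ω : Submodule ℂ V)
    (W : ℕ → ℕ → Submodule ℂ V) (D₁ D₂ : V → V) : Prop where
  indep : iSupIndep fun pq : ℕ × ℕ => W pq.1 pq.2
  iSup_eq : ⨆ pq : ℕ × ℕ, W pq.1 pq.2 = Ω
  add₁ : ∀ φ ∈ Ω, ∀ ψ ∈ Ω, D₁ (φ + ψ) = D₁ φ + D₁ ψ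
  add₂ : ∀ φ ∈ Ω, ∀ ψ ∈ Ω, D₂ (φ + ψ) = D₂ φ + D₂ ψ
  smul₁ : ∀ c : ℂ, ∀ φ ∈ Ω, D₁ (c • φ) = c • D₁ φ
  smul₂ : ∀ c : ℂ, ∀ φ ∈ Ω, D₂ (c • φ) = c • D₂ φ
  bideg₁ : ∀ p q, ∀ φ ∈ W p q, D₁ φ ∈ W (p + 1) q
  bideg₂ : ∀ p q, ∀ φ ∈ W p q, D₂ φ ∈ W p (q + 1)
  sq₁ : ∀ φ ∈ Ω, D₁ (D₁ φ) = 0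
  sq₂ : ∀ φ ∈ Ω, D₂ (D₂ φ) = 0
  anticomm : ∀ φ ∈ Ω, D₁ (D₂ φ) + D₂ (D₁ φ) = 0

/-- `f` restricts to a linear bijection `Ω ≃ Ω'` which maps each piece `W p q` onto `W' p q` and
intertwines both differentials. -/
structure IsDoubleComplexIso {V V' : Type*} [AddCommGroup V] [Module ℂ V] [AddCommGroup V']
    [Module ℂ V'] (Ω : Submodule ℂ V) (W : ℕ → ℕ → Submodule ℂ V) (D₁ D₂ : V → V)
    (Ω' : Submodule ℂ V') (W' : ℕ → ℕ → Submodule ℂ V') (D₁' D₂' : V' → V') (f : V → V') :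
    Prop where
  add : ∀ φ ∈ Ω, ∀ ψ ∈ Ω, f (φ + ψ) = f φ + f ψ
  smul : ∀ c : ℂ, ∀ φ ∈ Ω, f (c • φ) = c • f φ
  bijOn : Set.BijOn f Ω Ω'
  bijOn_piece : ∀ p q, Set.BijOn f (W p q) (W' p q)
  comm₁ : ∀ φ ∈ Ω, f (D₁ φ) = D₁' (f φ)
  comm₂ : ∀ φ ∈ Ω, f (D₂ φ) = D₂' (f φ)

/-- The normalizing constant `(-1)^n 𝐢 / 2`. -/
def ftConst (n : ℕ) : ℂ := (-1) ^ n * Complex.I / 2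

end SemiFlat

end

noncomputable section

set_option linter.unusedSectionVars false

namespace SemiFlat

/-! ### Calculus with contractions and substitutions -/

section Coframe

variable {σ τ : Type} [Fintype σ] [DecidableEq σ] [Fintype τ] [DecidableEq τ]

/-! A form whose coefficients depend only on `r` is the pull-back of a section over `B`. The
integrals over the torus fibres are then integrals of constants over a cube of volume one, so both
transforms act pointwise, through linear maps `ftLin` and `ftInvLin` of exterior algebras. The
kernel exp(∑ dθ̌_i ∧ dθ_i) exchanges multiplication and contraction, as a Fourier kernel does:
`ftLin` turns dz̄_i ∧ into (-1)^n dr_i ∧ (`ftLin_dzbar_mul`) and dz_i ∧ into (-1)^(n+1) ι_{∂/∂θ_i}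
(`ftLin_dz_mul`), while `ftInvLin` does the reverse (`ftInvLin_dr_mul`, `ftInvLin_contr`). As
`ftLin` sends 1 to a nonzero multiple of dθ_1 ∧ … ∧ dθ_n and `ftInvLin` sends that top form back to
1, the composite commutes with all one-forms and is a nonzero scalar (`exists_ftInvLin_ftLin`). Each
dz removes a dθ and each dz̄ adds a dr, which gives the match of bidegrees
(`map_ftLin_pieceMirror`).

On such forms every differential has the shape ∑ M_i ∂/∂r_i with a constant algebraic symbol M_i:
-(𝐢/2) dz_i for ∂, (𝐢/2) dz̄_i for ∂̄, dr_i for d, and ι_{∂/∂θ_i} for d^Λ, because the commutator of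
dr_i ∧ with Λ is ι_{∂/∂θ_i} (`dr_mul_lefschetz_sub`). Intertwining the differentials is thus a
statement about symbols, and the constants multiply to (-1)^n 𝐢/2 (`ftLin_symDel`,
`ftLin_symDelBar`). The double complex identities hold because the symbols anticommute and partial
derivatives commute.

These local facts globalize because the transitions are locally affine of determinant one. The frame
changes are locally constant, so they commute with differentiation, and the Jacobian from the chain
rule cancels its inverse from the symbol (`frame_baseOp`). Determinant one preserves the top form
dθ_1 ∧ … ∧ dθ_n, so `ftLin` respects frames (`ftLin_frameMirror`). The double complex is established
once, over `B` (`isDoubleComplex_base`), and carried to X̌ and to X by injective linear maps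
(`IsDoubleComplex.map`, `IsDoubleComplex.iso_of_maps`). -/

theorem ι_eq_sum_dx (m : σ → ℂ) : ExteriorAlgebra.ι ℂ m = ∑ s, m s • dx s := by
  conv_lhs => rw [pi_eq_sum_univ' m]
  rw [map_sum]
  refine Finset.sum_congr rfl fun s _ => ?_
  rw [map_smul, dx]

theorem submodule_eq_top_of_ι_mul_mem {U : Submodule ℂ (Ext σ)} (h1 : 1 ∈ U)
    (h : ∀ m : σ → ℂ, ∀ x ∈ U, ExteriorAlgebra.ι ℂ m * x ∈ U) : U = ⊤ := by
  rw [eq_top_iff]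
  rintro x -
  induction x using CliffordAlgebra.left_induction with
  | algebraMap r => rw [Algebra.algebraMap_eq_smul_one]; exact U.smul_mem r h1
  | add x y hx hy => exact U.add_mem hx hy
  | ι_mul x m hx => exact h m x hx

theorem submodule_eq_top_of_dx_mul_mem {U : Submodule ℂ (Ext σ)} (h1 : 1 ∈ U)
    (h : ∀ s, ∀ x ∈ U, dx s * x ∈ U) : U = ⊤ := by
  refine submodule_eq_top_of_ι_mul_mem h1 fun m x hx => ?_
  rw [ι_eq_sum_dx, Finset.sum_mul]
  exact U.sum_mem fun s _ => by rw [smul_mul_assoc]; exact U.smul_mem _ (h s x hx)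

/-- The induction principle behind most fibrewise identities: the exterior algebra is reached from 1
by repeated left multiplication by coordinate one-forms. -/
theorem linearMap_ext_dx_mul {V : Type*} [AddCommGroup V] [Module ℂ V] {f g : Ext σ →ₗ[ℂ] V}
    (h1 : f 1 = g 1) (h : ∀ s x, f x = g x → f (dx s * x) = g (dx s * x)) : f = g := by
  rw [← LinearMap.eqLocus_eq_top]
  exact submodule_eq_top_of_dx_mul_mem h1 h

theorem ι_mul_ι_swap (v w : σ → ℂ) :
    ExteriorAlgebra.ι ℂ v * ExteriorAlgebra.ι ℂ w
      = -(ExteriorAlgebra.ι ℂ w * ExteriorAlgebra.ι ℂ v) :=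
  eq_neg_of_add_eq_zero_left (ExteriorAlgebra.ι_add_mul_swap v w)

theorem dx_mul_dx_swap (s t : σ) : (dx s : Ext σ) * dx t = -(dx t * dx s) := ι_mul_ι_swap _ _

theorem dx_mul_self (s : σ) : (dx s : Ext σ) * dx s = 0 := ExteriorAlgebra.ι_sq_zero _

theorem contr_ι_mul (s : σ) (m : σ → ℂ) (x : Ext σ) :
    contr s (ExteriorAlgebra.ι ℂ m * x) = m s • x - ExteriorAlgebra.ι ℂ m * contr s x :=
  CliffordAlgebra.contractLeft_ι_mul _ _ _

theorem contr_dx_mul (s t : σ) (x : Ext σ) :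
    contr s (dx t * x) = (if s = t then (1 : ℂ) else 0) • x - dx t * contr s x := by
  rw [dx, contr_ι_mul, Pi.single_apply]

theorem contr_dx_mul_of_ne {s t : σ} (h : s ≠ t) (x : Ext σ) :
    contr s (dx t * x) = -(dx t * contr s x) := by
  simp [contr_dx_mul, h]

theorem contr_dx_mul_self (s : σ) (x : Ext σ) : contr s (dx s * x) = x - dx s * contr s x := by
  simp [contr_dx_mul]

@[simp] theorem contr_one (s : σ) : contr s (1 : Ext σ) = 0 := CliffordAlgebra.contractLeft_one _ _

theorem contr_contr_self (s : σ) (x : Ext σ) : contr s (contr s x) = 0 :=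
  CliffordAlgebra.contractLeft_contractLeft _ _

theorem contr_contr_swap (s t : σ) (x : Ext σ) : contr s (contr t x) = -contr t (contr s x) :=
  CliffordAlgebra.contractLeft_comm _ _ _

theorem subst_ι (c : σ → τ → ℂ) (m : σ → ℂ) :
    subst c (ExteriorAlgebra.ι ℂ m) = ExteriorAlgebra.ι ℂ (∑ s, m s • c s) := by
  rw [subst, ExteriorAlgebra.map_apply_ι, Module.Basis.constr_apply_fintype]
  simp

@[simp] theorem subst_dx (c : σ → τ → ℂ) (s : σ) :
    subst c (dx s) = ExteriorAlgebra.ι ℂ (c s) := by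
  rw [dx, subst_ι]
  congr 1
  simp [Pi.single_apply, Finset.sum_ite_eq']

theorem algHom_ext_dx {A : Type*} [Ring A] [Algebra ℂ A] {f g : Ext σ →ₐ[ℂ] A}
    (h : ∀ s, f (dx s) = g (dx s)) : f = g := by
  have : f.toLinearMap = g.toLinearMap :=
    linearMap_ext_dx_mul (by simp) fun s x hx => by
      simp only [AlgHom.toLinearMap_apply] at hx ⊢
      rw [map_mul, map_mul, h, hx]
  exact AlgHom.toLinearMap_injective this

/-- Contraction pairs with the pulled-back one-forms through the transpose of the substitution:
∂/∂x_t is pushed forward to ∑ c s t ∂/∂x_s. All behaviour of contractions under frame changes and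
projections comes from this. -/
theorem contr_subst (c : σ → τ → ℂ) (t : τ) (x : Ext σ) :
    contr t (subst c x) = subst c (∑ s, c s t • contr s x) := by
  have : contr t ∘ₗ (subst c).toLinearMap
      = (subst c).toLinearMap ∘ₗ (∑ s, c s t • contr s) := by
    refine linearMap_ext_dx_mul (by simp) fun u x hx => ?_
    simp only [LinearMap.comp_apply, AlgHom.toLinearMap_apply, LinearMap.sum_apply,
      LinearMap.smul_apply] at hx ⊢
    rw [map_mul, subst_dx, contr_ι_mul, hx]
    have : ∀ s, c s t • contr s (dx u * x)
        = (c s t * (if s = u then (1 : ℂ) else 0)) • x - dx u * (c s t • contr s x) := by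
      intro s
      rw [contr_dx_mul, smul_sub, smul_smul, mul_smul_comm]
    simp only [this, Finset.sum_sub_distrib, ← Finset.mul_sum, map_sub, map_mul, subst_dx,
      ← Finset.sum_smul, map_smul]
    simp
  simpa using LinearMap.congr_fun this x

/-! ### Products of two one-forms and their exponentials -/

/-- Moving a one-form past two others changes the sign twice, so even products are central. -/
theorem commute_dx_mul_dx (a b : σ) (x : Ext σ) : Commute (dx a * dx b) x := by
  induction x using ExteriorAlgebra.induction with
  | algebraMap r => exact (Algebra.commutes r _).symm
  | ι m =>
    rw [ι_eq_sum_dx]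
    refine Commute.sum_right _ _ _ fun s _ => Commute.smul_right ?_ _
    change dx a * dx b * dx s = dx s * (dx a * dx b)
    rw [mul_assoc, dx_mul_dx_swap b s, mul_neg, ← mul_assoc, dx_mul_dx_swap a s]
    noncomm_ring
  | mul x y hx hy => exact hx.mul_right hy
  | add x y hx hy => exact hx.add_right hy

theorem contr_dx_mul_dx_mul (s a b : σ) (x : Ext σ) :
    contr s (dx a * dx b * x) = contr s (dx a * dx b) * x + dx a * dx b * contr s x := by
  have h := contr_dx_mul s b (1 : Ext σ)
  simp only [mul_one, contr_one, mul_zero, sub_zero] at h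
  rw [mul_assoc, contr_dx_mul, contr_dx_mul, contr_dx_mul, h]
  simp only [sub_mul, mul_sub, smul_mul_assoc, mul_smul_comm, mul_one]
  noncomm_ring

/-- `∑ i, dx (f i) ∧ dx (g i)`. -/
def pairing {n : ℕ} (f g : Fin n → σ) : Ext σ := ∑ i, dx (f i) * dx (g i)

section Pairing
variable {n : ℕ} (f g : Fin n → σ)

theorem commute_pairing (x : Ext σ) : Commute (pairing f g) x :=
  Commute.sum_left _ _ _ fun _ _ => commute_dx_mul_dx _ _ _

theorem isNilpotent_pairing : IsNilpotent (pairing f g) := by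
  refine Commute.isNilpotent_sum (fun i _ => ⟨2, ?_⟩) fun i j _ _ => commute_dx_mul_dx _ _ _
  rw [pow_two, mul_assoc, ← mul_assoc (dx (g i)), dx_mul_dx_swap (g i), neg_mul, mul_assoc,
    dx_mul_self]
  simp

theorem contr_pairing_mul (s : σ) (x : Ext σ) :
    contr s (pairing f g * x) = contr s (pairing f g) * x + pairing f g * contr s x := by
  simp only [pairing, Finset.sum_mul, map_sum, contr_dx_mul_dx_mul, Finset.sum_add_distrib]

/-- The power rule: contraction is an unsigned derivation on multiples of an even element, and that
element is central. -/
theorem contr_pairing_pow (s : σ) (k : ℕ) :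
    contr s (pairing f g ^ (k + 1))
      = ((k : ℂ) + 1) • (contr s (pairing f g) * pairing f g ^ k) := by
  induction k with
  | zero => simp
  | succ k ih =>
    rw [pow_succ', contr_pairing_mul, ih, mul_smul_comm, ← mul_assoc,
      (commute_pairing f g (contr s (pairing f g))).eq, mul_assoc, ← pow_succ']
    push_cast
    module

/-- The derivative of an exponential, by termwise application of the power rule. This identity makes
the kernel exchange contractions and multiplications. -/
theorem contr_exp_smul_pairing (s : σ) (c : ℂ) :
    contr s (IsNilpotent.exp (c • pairing f g))
      = c • (contr s (pairing f g) * IsNilpotent.exp (c • pairing f g)) := by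
  obtain ⟨k, hk⟩ := isNilpotent_pairing f g
  have hk' : (c • pairing f g) ^ k = 0 := by rw [smul_pow, hk, smul_zero]
  have hk'' : (c • pairing f g) ^ (k + 1) = 0 := by rw [pow_succ, hk', zero_mul]
  have hq : ∀ (q : ℚ) (x : Ext σ), q • x = (q : ℂ) • x :=
    fun q x => (Rat.cast_smul_eq_qsmul ℂ q x).symm
  -- The left series is truncated one term later than the right one: contraction kills its constant
  -- term and lowers the remaining exponents by one.
  conv_lhs => rw [IsNilpotent.exp_eq_sum hk'']
  rw [IsNilpotent.exp_eq_sum hk', Finset.sum_range_succ', map_add, map_sum]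
  simp only [hq, map_smul, smul_pow, contr_pairing_pow, Finset.mul_sum, Finset.smul_sum, pow_zero,
    contr_one, smul_zero, add_zero, mul_smul_comm, smul_smul]
  refine Finset.sum_congr rfl fun i _ => ?_
  congr 1
  have : ((i : ℂ) + 1) ≠ 0 := by exact_mod_cast Nat.succ_ne_zero i
  rw [Nat.factorial_succ]
  push_cast
  field_simp
  ring

end Pairing

/-! ### Iterated contractions -/

/-- Contraction with `∂/∂x_{l₁}` first, then with `∂/∂x_{l₂}`, and so on. -/
def contrList : List σ → Ext σ →ₗ[ℂ] Ext σ
  | [] => LinearMap.id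
  | s :: l => contrList l ∘ₗ contr s

theorem foldl_contr {ι : Type*} (g : ι → σ) (l : List ι) (ψ : Ext σ) :
    l.foldl (fun χ i => contr (g i) χ) ψ = contrList (l.map g) ψ := by
  induction l generalizing ψ with
  | nil => rfl
  | cons a l ih => simp [contrList, ih]

theorem contrList_dx_mul {s : σ} {l : List σ} (h : s ∉ l) (x : Ext σ) :
    contrList l (dx s * x) = (-1 : ℂ) ^ l.length • (dx s * contrList l x) := by
  induction l generalizing x with
  | nil => simp [contrList]
  | cons a l ih =>
    simp only [List.mem_cons, not_or] at h
    simp only [contrList, LinearMap.comp_apply, List.length_cons]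
    rw [contr_dx_mul_of_ne (Ne.symm h.1), map_neg, ih h.2, pow_succ]
    module

theorem contr_contrList (s : σ) (l : List σ) (x : Ext σ) :
    contr s (contrList l x) = (-1 : ℂ) ^ l.length • contrList l (contr s x) := by
  induction l generalizing x with
  | nil => simp [contrList]
  | cons a l ih =>
    simp only [contrList, LinearMap.comp_apply, List.length_cons]
    rw [ih, contr_contr_swap, map_neg, pow_succ]
    module

/-- The repeated contraction can be moved next to its twin, where the square is zero. This plays the
role of integration by parts along the fibre. -/
theorem contrList_contr_of_mem {s : σ} {l : List σ} (h : s ∈ l) (x : Ext σ) :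
    contrList l (contr s x) = 0 := by
  induction l generalizing x with
  | nil => simp at h
  | cons a l ih =>
    simp only [contrList, LinearMap.comp_apply]
    by_cases hs : s = a
    · rw [hs, contr_contr_self, map_zero]
    · rw [contr_contr_swap, map_neg, ih ((List.mem_cons.1 h).resolve_left hs), neg_zero]

theorem contr_prod_dx_of_notMem {s : σ} {l : List σ} (h : s ∉ l) :
    contr s (l.map dx).prod = (0 : Ext σ) := by
  induction l with
  | nil => simp
  | cons a l ih =>
    simp only [List.mem_cons, not_or] at h
    rw [List.map_cons, List.prod_cons, contr_dx_mul_of_ne h.1, ih h.2]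
    simp

theorem contrList_prod_dx {l : List σ} (h : l.Nodup) :
    contrList l (l.map dx).prod = (1 : Ext σ) := by
  induction l with
  | nil => rfl
  | cons a l ih =>
    rw [List.nodup_cons] at h
    simp only [contrList, LinearMap.comp_apply, List.map_cons, List.prod_cons]
    rw [contr_dx_mul_self, contr_prod_dx_of_notMem h.1, mul_zero, sub_zero, ih h.2]

end Coframe

/-! ### The Fourier-Mukai transforms on the fibres of the form bundles -/

section Fibrewise

variable {n : ℕ}

/-- The dz_i and dz̄_i also form a coframe over ℂ. Induction along them is preferable because the
transform treats each of the two kinds uniformly. -/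
theorem linearMap_ext_dz_mul {V : Type*} [AddCommGroup V] [Module ℂ V]
    {f g : Ext (Ix n) →ₗ[ℂ] V} (h1 : f 1 = g 1)
    (hz : ∀ i x, f x = g x → f (dz i * x) = g (dz i * x))
    (hzbar : ∀ i x, f x = g x → f (dzbar i * x) = g (dzbar i * x)) : f = g := by
  refine linearMap_ext_dx_mul h1 fun s x hx => ?_
  rcases s with i | i
  · have : (dx (Sum.inl i) : Ext (Ix n)) = (2 * Complex.I)⁻¹ • (dz i - dzbar i) := by
      have h2 : dz i - dzbar i = (2 * Complex.I) • (dx (Sum.inl i) : Ext (Ix n)) := by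
        rw [dz, dzbar, dr]; module
      rw [h2, inv_smul_smul₀ (by simp)]
    rw [this, smul_mul_assoc, map_smul, map_smul, sub_mul, map_sub, map_sub, hz i x hx,
      hzbar i x hx]
  · have : (dx (Sum.inr i) : Ext (Ix n)) = (2 : ℂ)⁻¹ • (dz i + dzbar i) := by
      have h2 : dz i + dzbar i = (2 : ℂ) • (dx (Sum.inr i) : Ext (Ix n)) := by
        rw [dz, dzbar, dth]; module
      rw [h2, inv_smul_smul₀ (by simp)]
    rw [this, smul_mul_assoc, map_smul, map_smul, add_mul, map_add, map_add, hz i x hx,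
      hzbar i x hx]

@[simp] theorem polSwitch_dz (i : Fin n) : polSwitch (dz i) = dth i := by
  have hI := Complex.I_ne_zero
  rw [dz, dth, dr, map_add, map_smul, polSwitch, subst_dx, subst_dx, dx, ← map_smul, ← map_add]
  congr 1
  simp only [Sum.elim_inl, Sum.elim_inr, smul_smul]
  rw [show Complex.I * (2 * Complex.I)⁻¹ = 2⁻¹ by field_simp]
  module

@[simp] theorem polSwitch_dzbar (i : Fin n) : polSwitch (dzbar i) = dr i := by
  have hI := Complex.I_ne_zero
  rw [dzbar, dth, dr, map_sub, map_smul, polSwitch, subst_dx, subst_dx, dx, ← map_smul, ← map_sub]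
  congr 1
  simp only [Sum.elim_inl, Sum.elim_inr, smul_smul]
  rw [show Complex.I * (2 * Complex.I)⁻¹ = 2⁻¹ by field_simp]
  module

@[simp] theorem polSwitchInv_dth (i : Fin n) : polSwitchInv (dth i) = dz i := by
  simp [polSwitchInv, dth, dz, dr, subst_dx]; simp [dx]

@[simp] theorem polSwitchInv_dr (i : Fin n) : polSwitchInv (dr i) = dzbar i := by
  simp [polSwitchInv, dth, dzbar, dr, subst_dx]; simp [dx]

/-- The algebra homomorphism from forms on the fibre product to forms on `X` with `d θ̌_i ↦ 0`. -/
def collapseDual : Ext (Ix₂ n) →ₐ[ℂ] Ext (Ix n) :=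
  subst fun s => Sum.elim (fun i => Pi.single (Sum.inl i) 1)
      (Sum.elim (fun i => Pi.single (Sum.inr i) 1) fun _ => 0) s

/-- The algebra homomorphism from forms on the fibre product to forms on the mirror with
`d θ_i ↦ 0`. -/
def collapseX : Ext (Ix₂ n) →ₐ[ℂ] Ext (Ix n) :=
  subst fun s => Sum.elim (fun i => Pi.single (Sum.inl i) 1)
      (Sum.elim (fun _ => 0) fun i => Pi.single (Sum.inr i) 1) s

/-- The list of the directions `∂/∂θ_i` of the fibre product. -/
def listX (n : ℕ) : List (Ix₂ n) := (List.finRange n).map fun i => Sum.inr (Sum.inl i)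

/-- The list of the directions `∂/∂θ̌_i` of the fibre product. -/
def listDual (n : ℕ) : List (Ix₂ n) := (List.finRange n).map fun i => Sum.inr (Sum.inr i)

/-- `∑ d θ̌_i ∧ d θ_i`. -/
def poincare (n : ℕ) : Ext (Ix₂ n) :=
  pairing (fun i => Sum.inr (Sum.inr i)) (fun i => Sum.inr (Sum.inl i))

/-- `exp (∑ d θ̌_i ∧ d θ_i)`, up to the factor `c` in the exponent. -/
def expPoincare (n : ℕ) (c : ℂ) : Ext (Ix₂ n) := IsNilpotent.exp (c • poincare n)

/-- The transform `FT` from `X̌` to `X` on the fibres of the form bundles. -/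
def ftLin (n : ℕ) : Ext (Ix n) →ₗ[ℂ] Ext (Ix n) :=
  collapseDual.toLinearMap ∘ₗ contrList (listDual n) ∘ₗ
    (LinearMap.mulRight ℂ (expPoincare n 1)) ∘ₗ (pullDual.comp polSwitch).toLinearMap

/-- The transform `FT` from `X` to `X̌` on the fibres of the form bundles. -/
def ftInvLin (n : ℕ) : Ext (Ix n) →ₗ[ℂ] Ext (Ix n) :=
  (polSwitchInv.comp collapseX).toLinearMap ∘ₗ contrList (listX n) ∘ₗ
    (LinearMap.mulRight ℂ (expPoincare n (-1))) ∘ₗ pullX.toLinearMap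

theorem ftLin_apply (x : Ext (Ix n)) :
    ftLin n x = collapseDual (contrList (listDual n) (pullDual (polSwitch x) * expPoincare n 1)) :=
  rfl

theorem ftInvLin_apply (x : Ext (Ix n)) :
    ftInvLin n x
      = polSwitchInv (collapseX (contrList (listX n) (pullX x * expPoincare n (-1)))) := rfl

theorem inv_smul_curvature : (2 * Complex.I)⁻¹ • (curvature : Ext (Ix₂ n)) = poincare n := by
  rw [curvature, inv_smul_smul₀ (by simp)]
  rfl

theorem stripDual_eq (x : Ext (Ix n)) :
    stripDual (pullDual (polSwitch x) * IsNilpotent.exp ((2 * Complex.I)⁻¹ • curvature))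
      = ftLin n x := by
  rw [ftLin_apply, stripDual, foldl_contr, inv_smul_curvature, expPoincare, one_smul]
  rfl

theorem stripX_eq (x : Ext (Ix n)) :
    polSwitchInv (stripX (pullX x * IsNilpotent.exp (-(2 * Complex.I)⁻¹ • curvature)))
      = ftInvLin n x := by
  rw [ftInvLin_apply, stripX, foldl_contr, neg_smul, inv_smul_curvature, expPoincare, neg_one_smul]
  rfl

@[simp] theorem length_listX : (listX n).length = n := by simp [listX]
@[simp] theorem length_listDual : (listDual n).length = n := by simp [listDual]

/-! ### Commutation of the transforms with one-forms and contractions -/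

theorem contr_poincare (i : Fin n) :
    contr (Sum.inr (Sum.inl i)) (poincare n) = -dx (Sum.inr (Sum.inr i)) := by
  rw [poincare, pairing, map_sum, Finset.sum_eq_single i]
  · rw [contr_dx_mul_of_ne (by simp)]
    have := contr_dx_mul_self (Sum.inr (Sum.inl i) : Ix₂ n) 1
    simp only [mul_one, contr_one, mul_zero, sub_zero] at this
    rw [this, mul_one]
  · intro j _ hj
    rw [contr_dx_mul_of_ne (by simp)]
    have := contr_dx_mul_of_ne (s := (Sum.inr (Sum.inl i) : Ix₂ n)) (t := Sum.inr (Sum.inl j))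
      (by simpa using Ne.symm hj) 1
    simp only [mul_one, contr_one, mul_zero, neg_zero] at this
    rw [this, mul_zero, neg_zero]
  · simp

theorem contr_dual_poincare (i : Fin n) :
    contr (Sum.inr (Sum.inr i)) (poincare n) = dx (Sum.inr (Sum.inl i)) := by
  have h1 : ∀ j : Fin n,
      contr (Sum.inr (Sum.inr i)) (dx (Sum.inr (Sum.inl j)) : Ext (Ix₂ n)) = 0 := by
    intro j
    have := contr_dx_mul_of_ne (s := (Sum.inr (Sum.inr i) : Ix₂ n)) (t := Sum.inr (Sum.inl j))
      (by simp) 1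
    simpa using this
  rw [poincare, pairing, map_sum, Finset.sum_eq_single i]
  · rw [contr_dx_mul_self, h1, mul_zero, sub_zero]
  · intro j _ hj
    rw [contr_dx_mul_of_ne (by simpa using Ne.symm hj), h1, mul_zero, neg_zero]
  · simp

theorem contr_expPoincare (i : Fin n) (c : ℂ) :
    contr (Sum.inr (Sum.inl i)) (expPoincare n c)
      = -c • (dx (Sum.inr (Sum.inr i)) * expPoincare n c) := by
  have := contr_exp_smul_pairing (fun i : Fin n => (Sum.inr (Sum.inr i) : Ix₂ n))
    (fun i => Sum.inr (Sum.inl i)) (Sum.inr (Sum.inl i)) c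
  rw [← poincare, contr_poincare, ← expPoincare] at this
  rw [this, neg_mul, smul_neg, neg_smul]

theorem contr_dual_expPoincare (i : Fin n) (c : ℂ) :
    contr (Sum.inr (Sum.inr i)) (expPoincare n c)
      = c • (dx (Sum.inr (Sum.inl i)) * expPoincare n c) := by
  have := contr_exp_smul_pairing (fun i : Fin n => (Sum.inr (Sum.inr i) : Ix₂ n))
    (fun i => Sum.inr (Sum.inl i)) (Sum.inr (Sum.inr i)) c
  rwa [← poincare, contr_dual_poincare, ← expPoincare] at this

/-- The polarization switch makes dz̄_i into dr_i, which anticommutes past each of the n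
contractions of the fibre integral. -/
theorem ftLin_dzbar_mul (i : Fin n) (x : Ext (Ix n)) :
    ftLin n (dzbar i * x) = (-1 : ℂ) ^ n • (dr i * ftLin n x) := by
  have h : pullDual (dr i) = dx (Sum.inl i) := by rw [pullDual, dr, subst_dx]; rfl
  have h' : collapseDual (dx (Sum.inl i)) = dr i := by rw [collapseDual, subst_dx]; rfl
  rw [ftLin_apply, map_mul polSwitch, polSwitch_dzbar, map_mul pullDual, h, mul_assoc,
    contrList_dx_mul (by simp [listDual]), map_smul, map_mul, h', length_listDual, ← ftLin_apply]

/-- A form from the mirror contains no dθ, so the contraction sees only the exponential and brings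
down -dθ̌_i. The two sides pick up the same signs as `y` is built from one-forms. -/
theorem contr_pullDual_mul (i : Fin n) (y : Ext (Ix n)) :
    contr (Sum.inr (Sum.inl i)) (pullDual y * expPoincare n 1)
      = -(dx (Sum.inr (Sum.inr i)) * (pullDual y * expPoincare n 1)) := by
  -- Both sides are presented as linear maps in `z`, so that induction on generators applies.
  have h1 : ∀ z : Ext (Ix n), contr (Sum.inr (Sum.inl i)) (pullDual z * expPoincare n 1)
      = (contr (Sum.inr (Sum.inl i)) ∘ₗ LinearMap.mulRight ℂ (expPoincare n 1) ∘ₗ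
          pullDual.toLinearMap) z := fun z => rfl
  have h2 : ∀ z : Ext (Ix n), -(dx (Sum.inr (Sum.inr i)) * (pullDual z * expPoincare n 1))
      = (-(LinearMap.mulLeft ℂ (dx (Sum.inr (Sum.inr i))) ∘ₗ
          LinearMap.mulRight ℂ (expPoincare n 1) ∘ₗ pullDual.toLinearMap)) z := fun z => rfl
  rw [h1, h2]
  congr 1
  refine linearMap_ext_dx_mul ?_ fun s x hx => ?_
  · rw [← h1, ← h2, map_one, one_mul, contr_expPoincare, neg_one_smul]
  · rw [← h1, ← h2] at hx ⊢
    rw [map_mul pullDual, mul_assoc]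
    obtain ⟨t, ht, hs⟩ : ∃ t : Ix₂ n, t ≠ Sum.inr (Sum.inl i) ∧ pullDual (dx s) = dx t := by
      rcases s with j | j
      · exact ⟨Sum.inl j, by simp, by rw [pullDual, subst_dx]; rfl⟩
      · exact ⟨Sum.inr (Sum.inr j), by simp, by rw [pullDual, subst_dx]; rfl⟩
    rw [hs, contr_dx_mul_of_ne ht.symm, hx, mul_neg, neg_neg, ← mul_assoc, dx_mul_dx_swap]
    noncomm_ring

theorem contr_collapseDual (i : Fin n) (x : Ext (Ix₂ n)) :
    contr (Sum.inr i) (collapseDual x) = collapseDual (contr (Sum.inr (Sum.inl i)) x) := by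
  rw [collapseDual, contr_subst]
  congr 1
  simp [Fintype.sum_sum_type, Pi.single_apply]

/-- Multiplication by dθ̌_i under the integral is minus contraction with ∂/∂θ_i, which then leaves
the integral past n contractions with ∂/∂θ̌_j: hence n + 1 signs. -/
theorem ftLin_dz_mul (i : Fin n) (x : Ext (Ix n)) :
    ftLin n (dz i * x) = (-1 : ℂ) ^ (n + 1) • contr (Sum.inr i) (ftLin n x) := by
  have h : pullDual (dth i) = dx (Sum.inr (Sum.inr i)) := by rw [pullDual, dth, subst_dx]; rfl
  rw [ftLin_apply x, contr_collapseDual, contr_contrList, contr_pullDual_mul, ftLin_apply,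
    map_mul polSwitch, polSwitch_dz, map_mul pullDual, h, map_neg, length_listDual, smul_neg,
    map_neg, map_smul, smul_neg,
    smul_smul, ← neg_smul, mul_assoc, pow_succ, mul_neg_one, neg_mul, neg_neg, ← mul_pow]
  simp

theorem ftInvLin_dr_mul (i : Fin n) (x : Ext (Ix n)) :
    ftInvLin n (dr i * x) = (-1 : ℂ) ^ n • (dzbar i * ftInvLin n x) := by
  have h : pullX (dr i) = dx (Sum.inl i) := by rw [pullX, dr, subst_dx]; rfl
  have h' : collapseX (dx (Sum.inl i)) = dr i := by rw [collapseX, subst_dx]; rfl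
  rw [ftInvLin_apply, map_mul pullX, h, mul_assoc, contrList_dx_mul (by simp [listX]), map_smul,
    map_mul, h', map_smul, map_mul, polSwitchInv_dr, length_listX, ← ftInvLin_apply]

/-- Leibniz rule for φ ∧ exp(-∑ dθ̌_j ∧ dθ_j). Here φ may itself contain dθ_i, which accounts for
the first term; the sign from the exponent cancels the sign of `contr_poincare`. -/
theorem contr_pullX_mul (i : Fin n) (y : Ext (Ix n)) :
    contr (Sum.inr (Sum.inl i)) (pullX y * expPoincare n (-1))
      = pullX (contr (Sum.inr i) y) * expPoincare n (-1)
        + dx (Sum.inr (Sum.inr i)) * (pullX y * expPoincare n (-1)) := by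
  have h1 : ∀ z : Ext (Ix n), contr (Sum.inr (Sum.inl i)) (pullX z * expPoincare n (-1))
      = (contr (Sum.inr (Sum.inl i)) ∘ₗ LinearMap.mulRight ℂ (expPoincare n (-1)) ∘ₗ
          pullX.toLinearMap) z := fun z => rfl
  have h2 : ∀ z : Ext (Ix n), pullX (contr (Sum.inr i) z) * expPoincare n (-1)
        + dx (Sum.inr (Sum.inr i)) * (pullX z * expPoincare n (-1))
      = (LinearMap.mulRight ℂ (expPoincare n (-1)) ∘ₗ pullX.toLinearMap ∘ₗ contr (Sum.inr i) +
          LinearMap.mulLeft ℂ (dx (Sum.inr (Sum.inr i))) ∘ₗ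
          LinearMap.mulRight ℂ (expPoincare n (-1)) ∘ₗ pullX.toLinearMap) z := fun z => rfl
  rw [h1, h2]
  congr 1
  refine linearMap_ext_dx_mul ?_ fun s x hx => ?_
  · rw [← h1, ← h2, map_one, one_mul, contr_expPoincare]
    simp
  · rw [← h1, ← h2] at hx ⊢
    rw [map_mul pullX, mul_assoc]
    obtain ⟨t, hs, hst⟩ : ∃ t : Ix₂ n, pullX (dx s) = dx t ∧
        (Sum.inr (Sum.inl i) = t ↔ Sum.inr i = s) := by
      rcases s with j | j
      · exact ⟨Sum.inl j, by rw [pullX, subst_dx]; rfl, by simp⟩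
      · exact ⟨Sum.inr (Sum.inl j), by rw [pullX, subst_dx]; rfl, by simp⟩
    rw [hs, contr_dx_mul, contr_dx_mul, hx, map_sub, map_smul, map_mul, hs, mul_add,
      ← mul_assoc (dx t) (dx (Sum.inr (Sum.inr i))), dx_mul_dx_swap t]
    simp only [hst, sub_mul, smul_mul_assoc]
    noncomm_ring

/-- The total contraction in the Leibniz rule `contr_pullX_mul` is killed by the fibre integral, so
its two terms are opposite after integration. -/
theorem ftInvLin_contr (i : Fin n) (x : Ext (Ix n)) :
    ftInvLin n (contr (Sum.inr i) x) = (-1 : ℂ) ^ (n + 1) • (dz i * ftInvLin n x) := by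
  have h' : collapseX (dx (Sum.inr (Sum.inr i))) = dth i := by rw [collapseX, subst_dx]; rfl
  have h := contr_pullX_mul i x
  rw [← sub_eq_iff_eq_add] at h
  rw [ftInvLin_apply, ← h, map_sub, contrList_contr_of_mem (by simp [listX]),
    contrList_dx_mul (by simp [listX]), zero_sub, map_neg, map_smul, map_mul, h', map_neg,
    map_smul, map_mul, polSwitchInv_dth, length_listX, ← ftInvLin_apply, pow_succ]
  module

/-- `d θ_1 ∧ … ∧ d θ_n`. -/
def thTop (n : ℕ) : Ext (Ix n) := ((List.finRange n).map dth).prod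

/-- Each contraction with ∂/∂θ̌_a brings one dθ_a down from the exponential, behind the factors `w`
already produced. Passing those costs (-1) to the length of `w`; only the nonvanishing of the
accumulated sign is needed later. -/
theorem exists_contrList_expPoincare (l : List (Fin n)) (w : List (Fin n)) :
    ∃ ε : ℂ, ε ≠ 0 ∧ contrList (l.map fun i => Sum.inr (Sum.inr i))
        ((w.map fun i => dx (Sum.inr (Sum.inl i))).prod * expPoincare n 1)
      = ε • (((w ++ l).map fun i => dx (Sum.inr (Sum.inl i))).prod * expPoincare n 1) := by
  induction l generalizing w with
  | nil => exact ⟨1, one_ne_zero, by simp [contrList]⟩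
  | cons a l ih =>
    obtain ⟨ε, hε, h⟩ := ih (w ++ [a])
    have key : ∀ w : List (Fin n), contr (Sum.inr (Sum.inr a))
        ((w.map fun i => dx (Sum.inr (Sum.inl i))).prod * expPoincare n 1)
        = (-1 : ℂ) ^ w.length •
          (((w ++ [a]).map fun i => dx (Sum.inr (Sum.inl i))).prod * expPoincare n 1) := by
      intro w
      induction w with
      | nil => simp [contr_dual_expPoincare]
      | cons b w ihw =>
        rw [List.map_cons, List.prod_cons, mul_assoc, contr_dx_mul_of_ne (by simp), ihw,
          List.cons_append, List.map_cons, List.prod_cons, mul_assoc, List.length_cons, pow_succ,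
          mul_smul_comm]
        module
    refine ⟨(-1) ^ w.length * ε, mul_ne_zero (by simp) hε, ?_⟩
    rw [List.map_cons, contrList, LinearMap.comp_apply, key, map_smul, h, smul_smul,
      List.append_assoc, List.singleton_append]

theorem exists_ftLin_one (n : ℕ) : ∃ ε : ℂ, ε ≠ 0 ∧ ftLin n 1 = ε • thTop n := by
  obtain ⟨ε, hε, h⟩ := exists_contrList_expPoincare (List.finRange n) []
  refine ⟨ε, hε, ?_⟩
  rw [List.map_nil, List.prod_nil, one_mul, List.nil_append] at h
  rw [ftLin_apply, map_one, map_one, one_mul, listDual, h, map_smul, map_mul, map_list_prod,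
    List.map_map]
  -- Every term of the exponent contains some dθ̌_i, and these are sent to 0.
  have h1 : collapseDual (expPoincare n 1) = 1 := by
    have hp : IsNilpotent ((1 : ℂ) • poincare n) := (isNilpotent_pairing _ _).smul _
    rw [expPoincare, IsNilpotent.map_exp hp collapseDual]
    have : collapseDual ((1 : ℂ) • poincare n) = 0 := by
      simp [poincare, pairing, collapseDual]
    rw [this, IsNilpotent.exp_zero]
  rw [h1, mul_one, thTop]
  congr 3
  funext i
  simp only [Function.comp_apply, collapseDual, subst_dx]
  rfl

theorem ftInvLin_thTop (n : ℕ) : ftInvLin n (thTop n) = 1 := by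
  have h1 : pullX (thTop n) = ((listX n).map dx).prod := by
    rw [thTop, map_list_prod, List.map_map, listX, List.map_map]
    congr 2
    funext i
    simp only [Function.comp_apply, pullX, dth, subst_dx]
    rfl
  have hkill : ∀ (l : List (Ix₂ n)) (s : Ix₂ n), s ∈ l → dx s * (l.map dx).prod = 0 := by
    intro l
    induction l with
    | nil => simp
    | cons a l ih =>
      intro s hs
      rw [List.map_cons, List.prod_cons, ← mul_assoc]
      rcases List.mem_cons.1 hs with rfl | hs
      · rw [dx_mul_self, zero_mul]
      · rw [dx_mul_dx_swap, neg_mul, mul_assoc, ih s hs, mul_zero, neg_zero]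
  -- Each dθ_i of the exponent already occurs in the top form, so only the constant term of the
  -- exponential survives.
  have h2 : poincare n * ((listX n).map dx).prod = 0 := by
    rw [poincare, pairing, Finset.sum_mul]
    refine Finset.sum_eq_zero fun i _ => ?_
    rw [mul_assoc, hkill _ _ (by simp [listX]), mul_zero]
  have h3 : ((listX n).map dx).prod * expPoincare n (-1) = ((listX n).map dx).prod := by
    obtain ⟨k, hk⟩ : IsNilpotent ((-1 : ℂ) • poincare n) := (isNilpotent_pairing _ _).smul _
    have hk' : ((-1 : ℂ) • poincare n) ^ (k + 1) = 0 := by rw [pow_succ, hk, zero_mul]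
    have h0 : ((listX n).map dx).prod * ((-1 : ℂ) • poincare n) = 0 := by
      have hc : ((listX n).map dx).prod * poincare n = poincare n * ((listX n).map dx).prod :=
        (commute_pairing _ _ _).eq.symm
      rw [mul_smul_comm, hc, h2, smul_zero]
    rw [expPoincare, IsNilpotent.exp_eq_sum hk', Finset.mul_sum, Finset.sum_range_succ',
      Finset.sum_eq_zero]
    · simp
    · intro i _
      rw [mul_smul_comm, pow_succ', ← mul_assoc, h0, zero_mul, smul_zero]
  rw [ftInvLin_apply, h1, h3, contrList_prod_dx, map_one, map_one]
  rw [listX]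
  exact (List.nodup_finRange n).map fun i j h => by simpa using h

/-- The two transforms are inverse to each other up to a constant. -/
theorem exists_ftInvLin_ftLin (n : ℕ) :
    ∃ ε : ℂ, ε ≠ 0 ∧ ∀ x, ftInvLin n (ftLin n x) = ε • x := by
  obtain ⟨ε, hε, h1⟩ := exists_ftLin_one n
  refine ⟨ε, hε, fun x => ?_⟩
  have hsq : ∀ k, ((-1 : ℂ) ^ k * (-1) ^ k) = 1 := fun k => by rw [← mul_pow]; simp
  -- The signs of the two transforms are equal and square to 1, so the composite commutes with left
  -- multiplication by dz_i and dz̄_i and is determined by its value at 1.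
  have : ftInvLin n ∘ₗ ftLin n = ε • LinearMap.id := by
    refine linearMap_ext_dz_mul ?_ (fun i x hx => ?_) fun i x hx => ?_
    · simp [h1, ftInvLin_thTop]
    · simp only [LinearMap.comp_apply, LinearMap.smul_apply, LinearMap.id_apply] at hx ⊢
      rw [ftLin_dz_mul, map_smul, ftInvLin_contr, hx, smul_smul, hsq, one_smul, mul_smul_comm]
    · simp only [LinearMap.comp_apply, LinearMap.smul_apply, LinearMap.id_apply] at hx ⊢
      rw [ftLin_dzbar_mul, map_smul, ftInvLin_dr_mul, hx, smul_smul, hsq, one_smul, mul_smul_comm]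
  exact LinearMap.congr_fun this x

theorem ftLin_bijective (n : ℕ) : Function.Bijective (ftLin n) := by
  obtain ⟨ε, hε, h⟩ := exists_ftInvLin_ftLin n
  have hinj : Function.Injective (ftLin n) := fun x y hxy =>
    smul_right_injective _ hε (by simp only [← h, hxy])
  exact ⟨hinj, LinearMap.injective_iff_surjective.1 hinj⟩

end Fibrewise

/-! ### Change of frame -/

section Frames

variable {n : ℕ}

/-- The change of coframe `d r ↦ J⁻¹ d r`, `d θ ↦ Jᵀ d θ` on `X`. -/
def frameX (J : Matrix (Fin n) (Fin n) ℝ) : Ext (Ix n) →ₐ[ℂ] Ext (Ix n) :=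
  subst fun s => Sum.elim
    (fun i => ∑ j, ((J⁻¹ i j : ℝ) : ℂ) • Pi.single (Sum.inl j) 1)
    (fun i => ∑ j, ((J j i : ℝ) : ℂ) • Pi.single (Sum.inr j) 1) s

/-- The change of coframe `d r ↦ J⁻¹ d r`, `d θ̌ ↦ J⁻¹ d θ̌` on the mirror. -/
def frameMirror (J : Matrix (Fin n) (Fin n) ℝ) : Ext (Ix n) →ₐ[ℂ] Ext (Ix n) :=
  subst fun s => Sum.elim
    (fun i => ∑ j, ((J⁻¹ i j : ℝ) : ℂ) • Pi.single (Sum.inl j) 1)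
    (fun i => ∑ j, ((J⁻¹ i j : ℝ) : ℂ) • Pi.single (Sum.inr j) 1) s

theorem frameX_dr (J : Matrix (Fin n) (Fin n) ℝ) (i : Fin n) :
    frameX J (dr i) = ∑ j, ((J⁻¹ i j : ℝ) : ℂ) • dr j := by
  rw [frameX, dr, subst_dx, Sum.elim_inl, map_sum]
  simp only [map_smul]
  rfl

theorem frameX_dth (J : Matrix (Fin n) (Fin n) ℝ) (i : Fin n) :
    frameX J (dth i) = ∑ j, ((J j i : ℝ) : ℂ) • dth j := by
  rw [frameX, dth, subst_dx, Sum.elim_inr, map_sum]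
  simp only [map_smul]
  rfl

theorem frameMirror_dr (J : Matrix (Fin n) (Fin n) ℝ) (i : Fin n) :
    frameMirror J (dr i) = ∑ j, ((J⁻¹ i j : ℝ) : ℂ) • dr j := by
  rw [frameMirror, dr, subst_dx, Sum.elim_inl, map_sum]
  simp only [map_smul]
  rfl

theorem frameMirror_dth (J : Matrix (Fin n) (Fin n) ℝ) (i : Fin n) :
    frameMirror J (dth i) = ∑ j, ((J⁻¹ i j : ℝ) : ℂ) • dth j := by
  rw [frameMirror, dth, subst_dx, Sum.elim_inr, map_sum]
  simp only [map_smul]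
  rfl

theorem frameMirror_dz (J : Matrix (Fin n) (Fin n) ℝ) (i : Fin n) :
    frameMirror J (dz i) = ∑ j, ((J⁻¹ i j : ℝ) : ℂ) • dz j := by
  simp only [dz, map_add, map_smul, frameMirror_dr, frameMirror_dth, smul_add,
    Finset.sum_add_distrib, Finset.smul_sum]
  simp only [smul_comm Complex.I]

theorem frameMirror_dzbar (J : Matrix (Fin n) (Fin n) ℝ) (i : Fin n) :
    frameMirror J (dzbar i) = ∑ j, ((J⁻¹ i j : ℝ) : ℂ) • dzbar j := by
  simp only [dzbar, map_sub, map_smul, frameMirror_dr, frameMirror_dth, smul_sub,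
    Finset.sum_sub_distrib, Finset.smul_sum]
  simp only [smul_comm Complex.I]

theorem sum_smul_sum_smul {V : Type*} [AddCommGroup V] [Module ℂ V]
    (P Q : Matrix (Fin n) (Fin n) ℝ) (v : Fin n → V) (i : Fin n) :
    ∑ j, ((P i j : ℝ) : ℂ) • ∑ k, ((Q j k : ℝ) : ℂ) • v k
      = ∑ k, (((P * Q) i k : ℝ) : ℂ) • v k := by
  simp only [Matrix.mul_apply, Finset.smul_sum, smul_smul, Complex.ofReal_sum, Finset.sum_smul,
    Complex.ofReal_mul]
  exact Finset.sum_comm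

theorem sum_smul_one {V : Type*} [AddCommGroup V] [Module ℂ V] (v : Fin n → V) (i : Fin n) :
    ∑ k, (((1 : Matrix (Fin n) (Fin n) ℝ) i k : ℝ) : ℂ) • v k = v i := by
  rw [Finset.sum_eq_single i]
  · simp
  · intro j _ hj
    simp [Matrix.one_apply_ne hj.symm]
  · simp

/-- The cocycle rule for coframes: dr transforms by inverses and dθ by transposes, and both
operations reverse products. -/
theorem frameX_mul (A J : Matrix (Fin n) (Fin n) ℝ) (x : Ext (Ix n)) :
    frameX (A * J) x = frameX A (frameX J x) := by
  have : frameX (A * J) = (frameX A).comp (frameX J) := by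
    refine algHom_ext_dx fun s => ?_
    rw [AlgHom.comp_apply]
    rcases s with i | i
    · change frameX (A * J) (dr i) = frameX A (frameX J (dr i))
      simp only [frameX_dr, map_sum, map_smul, sum_smul_sum_smul, Matrix.mul_inv_rev]
    · change frameX (A * J) (dth i) = frameX A (frameX J (dth i))
      simp only [frameX_dth, map_sum, map_smul]
      have := sum_smul_sum_smul J.transpose A.transpose (dth (n := n)) i
      simp only [Matrix.transpose_apply, ← Matrix.transpose_mul] at this
      exact this.symm
  exact DFunLike.congr_fun this x

theorem frameMirror_mul (A J : Matrix (Fin n) (Fin n) ℝ) (x : Ext (Ix n)) :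
    frameMirror (A * J) x = frameMirror A (frameMirror J x) := by
  have : frameMirror (A * J) = (frameMirror A).comp (frameMirror J) := by
    refine algHom_ext_dx fun s => ?_
    rw [AlgHom.comp_apply]
    rcases s with i | i
    · change frameMirror (A * J) (dr i) = frameMirror A (frameMirror J (dr i))
      simp only [frameMirror_dr, map_sum, map_smul, sum_smul_sum_smul, Matrix.mul_inv_rev]
    · change frameMirror (A * J) (dth i) = frameMirror A (frameMirror J (dth i))
      simp only [frameMirror_dth, map_sum, map_smul, sum_smul_sum_smul, Matrix.mul_inv_rev]
  exact DFunLike.congr_fun this x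

@[simp] theorem frameX_one (x : Ext (Ix n)) : frameX 1 x = x := by
  have : frameX 1 = AlgHom.id ℂ (Ext (Ix n)) := by
    refine algHom_ext_dx fun s => ?_
    rcases s with i | i
    · change frameX 1 (dr i) = dr i
      rw [frameX_dr, inv_one, sum_smul_one]
    · change frameX 1 (dth i) = dth i
      rw [frameX_dth, ← Matrix.transpose_one]
      exact sum_smul_one dth i
  rw [this, AlgHom.id_apply]

@[simp] theorem frameMirror_one (x : Ext (Ix n)) : frameMirror 1 x = x := by
  have : frameMirror 1 = AlgHom.id ℂ (Ext (Ix n)) := by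
    refine algHom_ext_dx fun s => ?_
    rcases s with i | i
    · change frameMirror 1 (dr i) = dr i
      rw [frameMirror_dr, inv_one, sum_smul_one]
    · change frameMirror 1 (dth i) = dth i
      rw [frameMirror_dth, inv_one, sum_smul_one]
  rw [this, AlgHom.id_apply]

/-! ### Frame changes of determinant one and their invariants -/

theorem inv_mul_of_det_eq_one {J : Matrix (Fin n) (Fin n) ℝ} (hJ : J.det = 1) : J⁻¹ * J = 1 :=
  Matrix.nonsing_inv_mul _ (by simp [hJ])

theorem mul_inv_of_det_eq_one {J : Matrix (Fin n) (Fin n) ℝ} (hJ : J.det = 1) : J * J⁻¹ = 1 :=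
  Matrix.mul_nonsing_inv _ (by simp [hJ])

theorem frameX_injective {J : Matrix (Fin n) (Fin n) ℝ} (hJ : J.det = 1) :
    Function.Injective (frameX J) := by
  refine Function.LeftInverse.injective (g := frameX J⁻¹) fun x => ?_
  rw [← frameX_mul, inv_mul_of_det_eq_one hJ, frameX_one]

theorem frameMirror_injective {J : Matrix (Fin n) (Fin n) ℝ} (hJ : J.det = 1) :
    Function.Injective (frameMirror J) := by
  refine Function.LeftInverse.injective (g := frameMirror J⁻¹) fun x => ?_
  rw [← frameMirror_mul, inv_mul_of_det_eq_one hJ, frameMirror_one]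

theorem contr_inr_frameX (J : Matrix (Fin n) (Fin n) ℝ) (k : Fin n) (x : Ext (Ix n)) :
    contr (Sum.inr k) (frameX J x) = ∑ i, ((J k i : ℝ) : ℂ) • frameX J (contr (Sum.inr i) x) := by
  rw [frameX, contr_subst, map_sum, Fintype.sum_sum_type]
  simp only [map_smul]
  simp [Pi.single_apply, Finset.sum_apply]

theorem contr_inl_frameX (J : Matrix (Fin n) (Fin n) ℝ) (k : Fin n) (x : Ext (Ix n)) :
    contr (Sum.inl k) (frameX J x)
      = ∑ i, ((J⁻¹ i k : ℝ) : ℂ) • frameX J (contr (Sum.inl i) x) := by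
  rw [frameX, contr_subst, map_sum, Fintype.sum_sum_type]
  simp only [map_smul]
  simp [Pi.single_apply, Finset.sum_apply]

/-- `∑ ι_{∂/∂r_i} ι_{∂/∂θ_i}`. -/
def lefschetz (n : ℕ) : Ext (Ix n) →ₗ[ℂ] Ext (Ix n) :=
  ∑ i, contr (Sum.inl i) ∘ₗ contr (Sum.inr i)

theorem lefschetz_apply (x : Ext (Ix n)) :
    lefschetz n x = ∑ i, contr (Sum.inl i) (contr (Sum.inr i) x) := by
  simp [lefschetz]

/-- The fields ∂/∂r_i and ∂/∂θ_i transform by mutually inverse matrices, up to transposition, so the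
bivector ∑ ∂/∂r_i ∧ ∂/∂θ_i is invariant. -/
theorem lefschetz_frameX {J : Matrix (Fin n) (Fin n) ℝ} (hJ : J.det = 1) (x : Ext (Ix n)) :
    lefschetz n (frameX J x) = frameX J (lefschetz n x) := by
  simp only [lefschetz_apply, contr_inr_frameX, map_sum, map_smul, contr_inl_frameX,
    Finset.smul_sum, smul_smul]
  rw [Finset.sum_comm]
  refine Finset.sum_congr rfl fun i _ => ?_
  rw [Finset.sum_comm, ← sum_smul_one
    (fun j => frameX J (contr (Sum.inl j) (contr (Sum.inr i) x))) i]
  refine Finset.sum_congr rfl fun j _ => ?_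
  have h : (1 : Matrix (Fin n) (Fin n) ℝ) i j = (1 : Matrix (Fin n) (Fin n) ℝ) j i := by
    simp [Matrix.one_apply, eq_comm]
  rw [← Finset.sum_smul, h, ← inv_mul_of_det_eq_one hJ, Matrix.mul_apply, Complex.ofReal_sum]
  congr 1
  exact Finset.sum_congr rfl fun k _ => by rw [Complex.ofReal_mul, mul_comm]

theorem thTop_eq_ιMulti :
    thTop n = ExteriorAlgebra.ιMulti ℂ n fun i => (Pi.single (Sum.inr i) 1 : Ix n → ℂ) := by
  rw [thTop, ExteriorAlgebra.ιMulti_apply, List.ofFn_eq_map]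
  rfl

/-- The top form is multiplied by det J = 1. Composing with an arbitrary functional gives a scalar
alternating map of n vectors in an n-dimensional space, which is a multiple of the determinant. -/
theorem frameX_thTop {J : Matrix (Fin n) (Fin n) ℝ} (hJ : J.det = 1) :
    frameX J (thTop n) = thTop n := by
  rw [← sub_eq_zero, ← Module.forall_dual_apply_eq_zero_iff ℂ]
  intro l
  rw [map_sub, sub_eq_zero]
  let inc : (Fin n → ℂ) →ₗ[ℂ] (Ix n → ℂ) :=
    (Pi.basisFun ℂ (Fin n)).constr ℂ fun i => Pi.single (Sum.inr i) 1
  have hinc : ∀ v, inc v = ∑ i, v i • (Pi.single (Sum.inr i) 1 : Ix n → ℂ) := fun v => by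
    rw [Module.Basis.constr_apply_fintype]; simp
  let f : (Fin n → ℂ) [⋀^Fin n]→ₗ[ℂ] ℂ :=
    l.compAlternatingMap ((ExteriorAlgebra.ιMulti ℂ n).compLinearMap inc)
  have hf : ∀ v, f v = l (ExteriorAlgebra.ιMulti ℂ n fun i => inc (v i)) := fun v => rfl
  have h1 : l (thTop n) = f (Pi.basisFun ℂ (Fin n)) := by
    rw [hf, thTop_eq_ιMulti]
    congr 2
    funext i
    rw [hinc, Finset.sum_eq_single i] <;> simp +contextual
  have h2 : l (frameX J (thTop n)) = f fun i j => ((J j i : ℝ) : ℂ) := by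
    rw [hf, thTop_eq_ιMulti, ExteriorAlgebra.ιMulti_apply, ExteriorAlgebra.ιMulti_apply,
      map_list_prod, List.map_ofFn]
    congr 3
    funext i
    rw [Function.comp_apply, frameX]
    refine (subst_dx _ _).trans ?_
    rw [hinc, Sum.elim_inr]
  rw [h1, h2]
  conv_lhs => rw [AlternatingMap.eq_smul_basis_det (Pi.basisFun ℂ (Fin n)) f]
  rw [AlternatingMap.smul_apply, Pi.basisFun_det_apply]
  have : (Matrix.of fun i j => ((J j i : ℝ) : ℂ)).det = 1 := by
    have h := congrArg (Complex.ofRealHom) hJ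
    rw [RingHom.map_det, map_one, ← Matrix.det_transpose] at h
    exact h
  rw [this, smul_eq_mul, mul_one]

/-- The fibrewise transform does not depend on the coordinates. On 1 this is invariance of the top
form; on dz_i the factor J⁻¹ of the one-form cancels the J by which contractions change. -/
theorem ftLin_frameMirror {J : Matrix (Fin n) (Fin n) ℝ} (hJ : J.det = 1) (x : Ext (Ix n)) :
    ftLin n (frameMirror J x) = frameX J (ftLin n x) := by
  have : ftLin n ∘ₗ (frameMirror J).toLinearMap = (frameX J).toLinearMap ∘ₗ ftLin n := by
    refine linearMap_ext_dz_mul ?_ (fun i x hx => ?_) fun i x hx => ?_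
    · obtain ⟨ε, _, h⟩ := exists_ftLin_one n
      simp [h, frameX_thTop hJ]
    · simp only [LinearMap.comp_apply, AlgHom.toLinearMap_apply] at hx ⊢
      rw [map_mul, frameMirror_dz, Finset.sum_mul, map_sum, ftLin_dz_mul, map_smul]
      simp only [smul_mul_assoc, map_smul, ftLin_dz_mul, hx, contr_inr_frameX]
      simp only [smul_comm _ ((-1 : ℂ) ^ (n + 1)), ← Finset.smul_sum]
      rw [sum_smul_sum_smul, inv_mul_of_det_eq_one hJ, sum_smul_one]
    · simp only [LinearMap.comp_apply, AlgHom.toLinearMap_apply] at hx ⊢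
      rw [map_mul, frameMirror_dzbar, Finset.sum_mul, map_sum, ftLin_dzbar_mul, map_smul,
        map_mul, frameX_dr, Finset.sum_mul, Finset.smul_sum]
      refine Finset.sum_congr rfl fun j _ => ?_
      rw [smul_mul_assoc, map_smul, ftLin_dzbar_mul, hx, smul_mul_assoc, smul_comm]
  exact LinearMap.congr_fun this x

end Frames

/-! ### The bigradings of the fibres -/

section Bigrading

variable {n : ℕ}

/-- The fibre of `Ω_B^{p,q}(X̌)`. -/
abbrev pieceMirror (n p q : ℕ) : Submodule ℂ (Ext (Ix n)) := biSpan dz dzbar p q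

/-- The fibre of the piece of bidegree `(p,q)` of the double complex on `X`. -/
def pieceX (n p q : ℕ) : Submodule ℂ (Ext (Ix n)) :=
  if p ≤ n then biSpan dth dr (n - p) q else ⊥

/-- Submodules absorb signs, so anticommuting generators have commuting spans. -/
theorem commute_span_of_anticommute {u v : Fin n → Ext (Ix n)}
    (h : ∀ i j, u i * v j = -(v j * u i)) :
    Commute (Submodule.span ℂ (Set.range u)) (Submodule.span ℂ (Set.range v)) := by
  have key : ∀ {u v : Fin n → Ext (Ix n)}, (∀ i j, u i * v j = -(v j * u i)) →
      Submodule.span ℂ (Set.range u) * Submodule.span ℂ (Set.range v)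
        ≤ Submodule.span ℂ (Set.range v) * Submodule.span ℂ (Set.range u) := by
    intro u v h
    rw [Submodule.span_mul_span, Submodule.span_le]
    rintro _ ⟨_, ⟨i, rfl⟩, _, ⟨j, rfl⟩, rfl⟩
    change u i * v j ∈ _
    rw [h]
    exact neg_mem (Submodule.mul_mem_mul (Submodule.subset_span ⟨j, rfl⟩)
      (Submodule.subset_span ⟨i, rfl⟩))
  exact le_antisymm (key h) (key fun i j => by rw [h, neg_neg])

theorem mul_mem_biSpan_left {u v : Fin n → Ext (Ix n)} {p q : ℕ} (i : Fin n) {x : Ext (Ix n)}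
    (hx : x ∈ biSpan u v p q) : u i * x ∈ biSpan u v (p + 1) q := by
  rw [biSpan, pow_succ', mul_assoc]
  exact Submodule.mul_mem_mul (Submodule.subset_span ⟨i, rfl⟩) hx

theorem mul_mem_biSpan_right {u v : Fin n → Ext (Ix n)} (h : ∀ i j, u i * v j = -(v j * u i))
    {p q : ℕ} (j : Fin n) {x : Ext (Ix n)}
    (hx : x ∈ biSpan u v p q) : v j * x ∈ biSpan u v p (q + 1) := by
  rw [biSpan, pow_succ', ← mul_assoc, ((commute_span_of_anticommute h).pow_left p).eq, mul_assoc]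
  exact Submodule.mul_mem_mul (Submodule.subset_span ⟨j, rfl⟩) hx

theorem dth_mul_dr_swap (i j : Fin n) : dth i * dr j = -(dr j * dth i) := dx_mul_dx_swap _ _

theorem dz_mul_dzbar_swap (i j : Fin n) : dz i * dzbar j = -(dzbar j * dz i) := by
  simp only [dz, dzbar, dth, dr, add_mul, mul_sub, sub_mul, mul_add, smul_mul_assoc, mul_smul_comm]
  rw [dx_mul_dx_swap (Sum.inr i) (Sum.inr j), dx_mul_dx_swap (Sum.inr i) (Sum.inl j),
    dx_mul_dx_swap (Sum.inl i) (Sum.inr j), dx_mul_dx_swap (Sum.inl i) (Sum.inl j)]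
  module

theorem dz_mul_dz_swap (i j : Fin n) : (dz i : Ext (Ix n)) * dz j = -(dz j * dz i) := by
  simp only [dz, dth, dr, add_mul, mul_add, smul_mul_assoc, mul_smul_comm]
  rw [dx_mul_dx_swap (Sum.inr i) (Sum.inr j), dx_mul_dx_swap (Sum.inr i) (Sum.inl j),
    dx_mul_dx_swap (Sum.inl i) (Sum.inr j), dx_mul_dx_swap (Sum.inl i) (Sum.inl j)]
  module

theorem dzbar_mul_dzbar_swap (i j : Fin n) :
    (dzbar i : Ext (Ix n)) * dzbar j = -(dzbar j * dzbar i) := by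
  simp only [dzbar, dth, dr, mul_sub, sub_mul, smul_mul_assoc, mul_smul_comm]
  rw [dx_mul_dx_swap (Sum.inr i) (Sum.inr j), dx_mul_dx_swap (Sum.inr i) (Sum.inl j),
    dx_mul_dx_swap (Sum.inl i) (Sum.inr j), dx_mul_dx_swap (Sum.inl i) (Sum.inl j)]
  module

theorem dz_mul_mem (i : Fin n) {p q : ℕ} {x : Ext (Ix n)} (hx : x ∈ pieceMirror n p q) :
    dz i * x ∈ pieceMirror n (p + 1) q := mul_mem_biSpan_left i hx

theorem dzbar_mul_mem (i : Fin n) {p q : ℕ} {x : Ext (Ix n)} (hx : x ∈ pieceMirror n p q) :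
    dzbar i * x ∈ pieceMirror n p (q + 1) := mul_mem_biSpan_right dz_mul_dzbar_swap i hx

theorem map_biSpan_le (f : Ext (Ix n) →ₐ[ℂ] Ext (Ix n)) {u v u' v' : Fin n → Ext (Ix n)}
    (hu : ∀ i, f (u i) ∈ Submodule.span ℂ (Set.range u'))
    (hv : ∀ i, f (v i) ∈ Submodule.span ℂ (Set.range v')) (p q : ℕ) :
    (biSpan u v p q).map f.toLinearMap ≤ biSpan u' v' p q := by
  have key : ∀ {u u' : Fin n → Ext (Ix n)}, (∀ i, f (u i) ∈ Submodule.span ℂ (Set.range u')) →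
      (Submodule.span ℂ (Set.range u)).map f.toLinearMap ≤ Submodule.span ℂ (Set.range u') := by
    intro u u' h
    rw [Submodule.map_span, Submodule.span_le]
    rintro _ ⟨_, ⟨i, rfl⟩, rfl⟩
    exact h i
  rw [biSpan, biSpan, Submodule.map_mul, Submodule.map_pow, Submodule.map_pow]
  exact mul_le_mul' (pow_le_pow_left' (key hu) p)
    (pow_le_pow_left' (key hv) q)

theorem frameMirror_mem (J : Matrix (Fin n) (Fin n) ℝ) {p q : ℕ} {x : Ext (Ix n)}
    (hx : x ∈ pieceMirror n p q) : frameMirror J x ∈ pieceMirror n p q := by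
  refine map_biSpan_le (frameMirror J) (fun i => ?_) (fun i => ?_) p q
    (Submodule.mem_map_of_mem hx)
  · rw [frameMirror_dz]
    exact Submodule.sum_mem _ fun j _ => Submodule.smul_mem _ _ (Submodule.subset_span ⟨j, rfl⟩)
  · rw [frameMirror_dzbar]
    exact Submodule.sum_mem _ fun j _ => Submodule.smul_mem _ _ (Submodule.subset_span ⟨j, rfl⟩)

theorem iSup_pieceMirror : ⨆ pq : ℕ × ℕ, pieceMirror n pq.1 pq.2 = ⊤ := by
  set U := ⨆ pq : ℕ × ℕ, pieceMirror n pq.1 pq.2 with hU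
  have hle : ∀ p q, pieceMirror n p q ≤ U := fun p q =>
    le_iSup (fun pq : ℕ × ℕ => pieceMirror n pq.1 pq.2) (p, q)
  have h1 : (1 : Ext (Ix n)) ∈ U := hle 0 0 (by simp [pieceMirror, biSpan])
  have hz : ∀ i, ∀ x ∈ U, dz i * x ∈ U := fun i => by
    have : U ≤ U.comap (LinearMap.mulLeft ℂ (dz i)) := by
      conv_lhs => rw [hU]
      exact iSup_le fun pq x hx => hle _ _ (dz_mul_mem i hx)
    exact this
  have hzbar : ∀ i, ∀ x ∈ U, dzbar i * x ∈ U := fun i => by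
    have : U ≤ U.comap (LinearMap.mulLeft ℂ (dzbar i)) := by
      conv_lhs => rw [hU]
      exact iSup_le fun pq x hx => hle _ _ (dzbar_mul_mem i hx)
    exact this
  -- The sum of the pieces contains 1 and is stable under dz_i and dz̄_i, so the quotient map by it
  -- vanishes by induction on generators.
  have : U.mkQ = 0 := by
    refine linearMap_ext_dz_mul ?_ (fun i x hx => ?_) fun i x hx => ?_
    · simpa using h1
    · simp only [LinearMap.zero_apply, Submodule.mkQ_apply, Submodule.Quotient.mk_eq_zero] at hx ⊢
      exact hz i x hx
    · simp only [LinearMap.zero_apply, Submodule.mkQ_apply, Submodule.Quotient.mk_eq_zero] at hx ⊢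
      exact hzbar i x hx
  rw [← Submodule.ker_mkQ U, this, LinearMap.ker_zero]

/-- The algebra endomorphism `d θ_i ↦ a d θ_i`, `d r_i ↦ b d r_i`. -/
def scaling (n : ℕ) (a b : ℂ) : Ext (Ix n) →ₐ[ℂ] Ext (Ix n) :=
  subst fun s => Sum.elim (fun i => b • Pi.single (Sum.inl i) 1)
    (fun i => a • Pi.single (Sum.inr i) 1) s

theorem eq_smul_of_mem_biSpan (f : Ext (Ix n) →ₐ[ℂ] Ext (Ix n)) {u v : Fin n → Ext (Ix n)}
    {a b : ℂ} (hu : ∀ i, f (u i) = a • u i) (hv : ∀ i, f (v i) = b • v i) {p q : ℕ}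
    {x : Ext (Ix n)} (hx : x ∈ biSpan u v p q) : f x = (a ^ p * b ^ q) • x := by
  have key : ∀ {u : Fin n → Ext (Ix n)} {a : ℂ}, (∀ i, f (u i) = a • u i) → ∀ {p : ℕ}
      {x : Ext (Ix n)}, x ∈ Submodule.span ℂ (Set.range u) ^ p → f x = a ^ p • x := by
    intro u a h p
    have h1 : ∀ {y}, y ∈ Submodule.span ℂ (Set.range u) → f y = a • y := by
      intro y hy
      induction hy using Submodule.span_induction with
      | mem y hy => obtain ⟨i, rfl⟩ := hy; exact h i
      | zero => simp
      | add y z _ _ hy hz => rw [map_add, hy, hz, smul_add]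
      | smul c y _ hy => rw [map_smul, hy, smul_comm]
    induction p with
    | zero =>
      intro x hx
      rw [pow_zero, Submodule.mem_one] at hx
      obtain ⟨c, rfl⟩ := hx
      simp
    | succ p ih =>
      intro x hx
      rw [pow_succ] at hx
      induction hx using Submodule.mul_induction_on' with
      | mem_mul_mem y hy z hz =>
        rw [map_mul, ih hy, h1 hz, smul_mul_smul_comm, pow_succ]
      | add y _ z _ hy hz => rw [map_add, hy, hz, smul_add]
  rw [biSpan] at hx
  induction hx using Submodule.mul_induction_on' with
  | mem_mul_mem y hy z hz => rw [map_mul, key hu hy, key hv hz, smul_mul_smul_comm]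
  | add y _ z _ hy hz => rw [map_add, hy, hz, smul_add]

/-- Unique factorization: the 2-adic and 3-adic valuations recover p and q. A single scaling
operator with weights 2 and 3 therefore separates all bidegrees. -/
theorem two_pow_mul_three_pow_injective :
    Function.Injective fun pq : ℕ × ℕ => (2 : ℂ) ^ pq.1 * 3 ^ pq.2 := by
  rintro ⟨p, q⟩ ⟨p', q'⟩ h
  have h' : 2 ^ p * 3 ^ q = 2 ^ p' * 3 ^ q' := by
    simp only at h
    exact_mod_cast h
  have h2 := congrArg (padicValNat 2) h'
  have h3 := congrArg (padicValNat 3) h'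
  have : Fact (Nat.Prime 3) := ⟨Nat.prime_three⟩
  have h23 : padicValNat 2 3 = 0 := padicValNat.eq_zero_of_not_dvd (by norm_num)
  have h32 : padicValNat 3 2 = 0 := padicValNat.eq_zero_of_not_dvd (by norm_num)
  rw [padicValNat.mul (by positivity) (by positivity),
    padicValNat.mul (by positivity) (by positivity)] at h2 h3
  simp only [padicValNat.pow, padicValNat.self (by norm_num : 1 < 2), h23,
    padicValNat.self (by norm_num : 1 < 3), h32] at h2 h3
  ext <;> simp_all

theorem iSupIndep_of_le_eigenspace {V : Type*} [AddCommGroup V] [Module ℂ V] {ι : Type*}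
    (f : Module.End ℂ V) {μ : ι → ℂ} (hμ : Function.Injective μ) {K : ι → Submodule ℂ V}
    (hK : ∀ i, K i ≤ f.eigenspace (μ i)) : iSupIndep K :=
  (f.eigenspaces_iSupIndep.comp hμ).mono hK

/-- The endomorphism `d z_i ↦ 2 d z_i`, `d z̄_i ↦ 3 d z̄_i`. -/
def scalingMirror (n : ℕ) : Ext (Ix n) →ₐ[ℂ] Ext (Ix n) :=
  polSwitchInv.comp ((scaling n 2 3).comp polSwitch)

theorem scaling_dth (a b : ℂ) (i : Fin n) : scaling n a b (dth i) = a • dth i := by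
  rw [scaling, dth, subst_dx, Sum.elim_inr, map_smul]
  rfl

theorem scaling_dr (a b : ℂ) (i : Fin n) : scaling n a b (dr i) = b • dr i := by
  rw [scaling, dr, subst_dx, Sum.elim_inl, map_smul]
  rfl

theorem scalingMirror_eq {p q : ℕ} {x : Ext (Ix n)} (hx : x ∈ pieceMirror n p q) :
    scalingMirror n x = ((2 : ℂ) ^ p * 3 ^ q) • x :=
  eq_smul_of_mem_biSpan _ (fun i => by simp [scalingMirror, scaling_dth])
    (fun i => by simp [scalingMirror, scaling_dr]) hx

/-- Giving dθ the weight 1/2 turns degree n - p into the factor 2^p, up to the common factor 2^(-n).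
The pieces with p > n are zero and lie in every eigenspace. -/
theorem iSupIndep_pieceX : iSupIndep fun pq : ℕ × ℕ => pieceX n pq.1 pq.2 := by
  have hinj : Function.Injective fun pq : ℕ × ℕ => (2⁻¹ : ℂ) ^ n * (2 ^ pq.1 * 3 ^ pq.2) :=
    (mul_right_injective₀ (by simp)).comp two_pow_mul_three_pow_injective
  refine iSupIndep_of_le_eigenspace (scaling n 2⁻¹ 3).toLinearMap hinj fun pq x hx => ?_
  rw [Module.End.mem_eigenspace_iff, AlgHom.toLinearMap_apply]
  simp only [pieceX] at hx
  split_ifs at hx with hp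
  · rw [eq_smul_of_mem_biSpan _ (scaling_dth _ _) (scaling_dr _ _) hx, ← mul_assoc]
    congr 2
    obtain ⟨k, hk⟩ := Nat.exists_eq_add_of_le hp
    rw [hk, Nat.add_sub_cancel_left, pow_add, mul_right_comm, ← mul_pow]
    simp
  · rw [Submodule.mem_bot] at hx
    simp [hx]

theorem contr_eq_zero_of_mem_biSpan (i : Fin n) (q : ℕ) :
    ∀ x ∈ biSpan (n := n) dth dr 0 q, contr (Sum.inr i) x = 0 := by
  induction q with
  | zero =>
    intro x hx
    rw [biSpan, pow_zero, pow_zero, one_mul, Submodule.mem_one] at hx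
    obtain ⟨c, rfl⟩ := hx
    rw [Algebra.algebraMap_eq_smul_one, map_smul, contr_one, smul_zero]
  | succ q ih =>
    intro x hx
    rw [biSpan, pow_zero, one_mul, pow_succ'] at hx
    induction hx using Submodule.mul_induction_on' with
    | mem_mul_mem v hv y hy =>
      have hy' := ih y (by rwa [biSpan, pow_zero, one_mul])
      induction hv using Submodule.span_induction with
      | mem v hv =>
        obtain ⟨j, rfl⟩ := hv
        rw [dr, contr_dx_mul_of_ne (by simp), hy', mul_zero, neg_zero]
      | zero => simp
      | add v w _ _ hv hw => rw [add_mul, map_add, hv, hw, add_zero]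
      | smul c v _ hv => rw [smul_mul_assoc, map_smul, hv, smul_zero]
    | add y _ z _ hy hz => rw [map_add, hy, hz, add_zero]

theorem exists_contr_mul_eq (i : Fin n) {u : Ext (Ix n)}
    (hu : u ∈ Submodule.span ℂ (Set.range (dth (n := n)))) :
    ∃ c : ℂ, ∀ y, contr (Sum.inr i) (u * y) = c • y - u * contr (Sum.inr i) y := by
  induction hu using Submodule.span_induction with
  | mem u hu =>
    obtain ⟨j, rfl⟩ := hu
    exact ⟨_, contr_dx_mul _ _⟩
  | zero => exact ⟨0, by simp⟩
  | add u v _ _ hu hv =>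
    obtain ⟨c, hc⟩ := hu
    obtain ⟨d, hd⟩ := hv
    exact ⟨c + d, fun y => by rw [add_mul, map_add, hc, hd, add_mul]; module⟩
  | smul a u _ hu =>
    obtain ⟨c, hc⟩ := hu
    exact ⟨a * c, fun y => by rw [smul_mul_assoc, map_smul, hc, smul_mul_assoc]; module⟩

theorem biSpan_succ (u v : Fin n → Ext (Ix n)) (a q : ℕ) :
    biSpan u v (a + 1) q = Submodule.span ℂ (Set.range u) * biSpan u v a q := by
  rw [biSpan, biSpan, pow_succ', mul_assoc]

theorem contr_mem_of_mem_biSpan (i : Fin n) (a q : ℕ) :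
    ∀ x ∈ biSpan dth dr (a + 1) q, contr (Sum.inr i) x ∈ biSpan (n := n) dth dr a q := by
  induction a with
  | zero =>
    intro x hx
    rw [biSpan_succ] at hx
    induction hx using Submodule.mul_induction_on' with
    | mem_mul_mem u hu y hy =>
      obtain ⟨c, hc⟩ := exists_contr_mul_eq i hu
      rw [hc, contr_eq_zero_of_mem_biSpan i q y hy, mul_zero, sub_zero]
      exact Submodule.smul_mem _ _ hy
    | add y _ z _ hy hz => rw [map_add]; exact add_mem hy hz
  | succ a ih =>
    intro x hx
    rw [biSpan_succ] at hx
    induction hx using Submodule.mul_induction_on' with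
    | mem_mul_mem u hu y hy =>
      obtain ⟨c, hc⟩ := exists_contr_mul_eq i hu
      rw [hc]
      refine sub_mem (Submodule.smul_mem _ _ hy) ?_
      rw [biSpan_succ]
      exact Submodule.mul_mem_mul hu (ih y hy)
    | add y _ z _ hy hz => rw [map_add]; exact add_mem hy hz

theorem contr_mem_pieceX (i : Fin n) {p q : ℕ} {x : Ext (Ix n)} (hx : x ∈ pieceX n p q) :
    contr (Sum.inr i) x ∈ pieceX n (p + 1) q := by
  rw [pieceX] at hx ⊢
  split_ifs at hx with hp
  · split_ifs with hp'
    · obtain ⟨k, hk⟩ := Nat.exists_eq_add_of_le hp'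
      have h1 : n - p = (n - (p + 1)) + 1 := by omega
      rw [h1] at hx
      exact contr_mem_of_mem_biSpan i _ q x hx
    -- Here p = n: no dθ is left to contract, which agrees with the target piece being zero.
    · have h1 : n - p = 0 := by omega
      rw [h1] at hx
      exact (Submodule.mem_bot ℂ).2 (contr_eq_zero_of_mem_biSpan i q x hx)
  · rw [(Submodule.mem_bot ℂ).1 hx, map_zero]
    exact zero_mem _

/-- The image of 1 has n factors dθ. Each dz̄ becomes a dr, raising q, and each dz becomes a
contraction that removes a dθ, raising p. -/
theorem ftLin_mem_pieceX (p q : ℕ) : ∀ x ∈ pieceMirror n p q, ftLin n x ∈ pieceX n p q := by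
  have hbase : ∀ q, ∀ x ∈ pieceMirror n 0 q, ftLin n x ∈ pieceX n 0 q := by
    intro q
    have hX : ∀ q, pieceX n 0 q = biSpan dth dr n q := fun q => by simp [pieceX]
    induction q with
    | zero =>
      intro x hx
      rw [pieceMirror, biSpan, pow_zero, pow_zero, one_mul, Submodule.mem_one] at hx
      obtain ⟨c, rfl⟩ := hx
      obtain ⟨ε, _, h⟩ := exists_ftLin_one n
      rw [Algebra.algebraMap_eq_smul_one, map_smul, h, hX, biSpan, pow_zero, mul_one]
      refine Submodule.smul_mem _ _ (Submodule.smul_mem _ _ ?_)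
      have key : ∀ l : List (Fin n), (l.map dth).prod
          ∈ Submodule.span ℂ (Set.range (dth (n := n))) ^ l.length := by
        intro l
        induction l with
        | nil => simp
        | cons a l ih =>
          rw [List.map_cons, List.prod_cons, List.length_cons, pow_succ']
          exact Submodule.mul_mem_mul (Submodule.subset_span ⟨a, rfl⟩) ih
      simpa [thTop] using key (List.finRange n)
    | succ q ih =>
      intro x hx
      rw [pieceMirror, biSpan, pow_zero, one_mul, pow_succ'] at hx
      induction hx using Submodule.mul_induction_on' with
      | mem_mul_mem v hv y hy =>
        have hy' := ih y (by rwa [pieceMirror, biSpan, pow_zero, one_mul])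
        induction hv using Submodule.span_induction with
        | mem v hv =>
          obtain ⟨j, rfl⟩ := hv
          rw [ftLin_dzbar_mul]
          rw [hX] at hy' ⊢
          exact Submodule.smul_mem _ _ (mul_mem_biSpan_right dth_mul_dr_swap j hy')
        | zero => simp
        | add v w _ _ hv hw => rw [add_mul, map_add]; exact add_mem hv hw
        | smul c v _ hv => rw [smul_mul_assoc, map_smul]; exact Submodule.smul_mem _ _ hv
      | add y _ z _ hy hz => rw [map_add]; exact add_mem hy hz
  induction p with
  | zero => exact hbase q
  | succ p ih =>
    intro x hx
    rw [pieceMirror, biSpan_succ] at hx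
    induction hx using Submodule.mul_induction_on' with
    | mem_mul_mem v hv y hy =>
      induction hv using Submodule.span_induction with
      | mem v hv =>
        obtain ⟨j, rfl⟩ := hv
        rw [ftLin_dz_mul]
        exact Submodule.smul_mem _ _ (contr_mem_pieceX j (ih y hy))
      | zero => simp
      | add v w _ _ hv hw => rw [add_mul, map_add]; exact add_mem hv hw
      | smul c v _ hv => rw [smul_mul_assoc, map_smul]; exact Submodule.smul_mem _ _ hv
    | add y _ z _ hy hz => rw [map_add]; exact add_mem hy hz

/-- By the modular law, K' i is K i joined with its intersection with the other K j, and that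
intersection vanishes by independence. It upgrades inclusions of pieces to equalities without a
separate argument for the inverse transform. -/
theorem eq_of_le_of_iSup_eq_top {α ι : Type*} [CompleteLattice α] [IsModularLattice α]
    {K K' : ι → α} (hK' : iSupIndep K') (hle : ∀ i, K i ≤ K' i) (htop : ⨆ i, K i = ⊤) (i : ι) :
    K i = K' i := by
  refine le_antisymm (hle i) ?_
  have h1 : K i ⊔ ⨆ (j) (_ : j ≠ i), K j = ⊤ := by
    rw [eq_top_iff, ← htop]
    refine iSup_le fun j => ?_
    by_cases hj : j = i
    · rw [hj]; exact le_sup_left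
    · exact le_sup_of_le_right (le_iSup₂_of_le j hj le_rfl)
  have h2 : (⨆ (j) (_ : j ≠ i), K j) ⊓ K' i = ⊥ := by
    rw [eq_bot_iff, ← (hK' i).eq_bot, inf_comm]
    exact inf_le_inf_left _ (iSup₂_mono fun j _ => hle j)
  calc K' i = (K i ⊔ ⨆ (j) (_ : j ≠ i), K j) ⊓ K' i := by rw [h1, top_inf_eq]
    _ = K i ⊔ (⨆ (j) (_ : j ≠ i), K j) ⊓ K' i := sup_inf_assoc_of_le _ (hle i)
    _ ≤ K i := by rw [h2, sup_bot_eq]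

theorem map_ftLin_pieceMirror (p q : ℕ) : (pieceMirror n p q).map (ftLin n) = pieceX n p q := by
  refine eq_of_le_of_iSup_eq_top (K := fun pq : ℕ × ℕ => (pieceMirror n pq.1 pq.2).map (ftLin n))
    iSupIndep_pieceX ?_ ?_ (p, q)
  · rintro ⟨p, q⟩ _ ⟨x, hx, rfl⟩
    exact ftLin_mem_pieceX p q x hx
  · rw [← Submodule.map_iSup, iSup_pieceMirror, Submodule.map_top]
    exact LinearMap.range_eq_top.2 (ftLin_bijective n).2

end Bigrading

/-! ### Calculus of functions with values in an exterior algebra -/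

section Calculus

variable {σ τ : Type} [Fintype σ] [DecidableEq σ] [Fintype τ] [DecidableEq τ]
  {κ κ' : Type} [Fintype κ] [DecidableEq κ] [Fintype κ'] [DecidableEq κ']

/-- Differentiability at a point of a function with values in an exterior algebra. -/
def ExtDifferentiableAt (f : (κ → ℝ) → Ext σ) (p : κ → ℝ) : Prop :=
  ∀ l : Module.Dual ℂ (Ext σ), DifferentiableAt ℝ (fun q => l (f q)) p

theorem ext_dual {x y : Ext σ} (h : ∀ l : Module.Dual ℂ (Ext σ), l x = l y) : x = y := by
  rw [← sub_eq_zero, ← Module.forall_dual_apply_eq_zero_iff ℂ]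
  intro l
  rw [map_sub, h, sub_self]

theorem dual_eq_sum (l : Module.Dual ℂ (Ext σ)) (x : Ext σ) :
    l x = ∑ j, (Module.finBasis ℂ (Ext σ)).repr x j * l (Module.finBasis ℂ (Ext σ) j) := by
  conv_lhs => rw [← (Module.finBasis ℂ (Ext σ)).sum_repr x, map_sum]
  simp only [map_smul, smul_eq_mul]

/-- Functionals commute with the componentwise derivative, so identities between `Ext σ`-valued
derivatives reduce to scalar calculus by `ext_dual`. -/
theorem dual_pderiv {f : (κ → ℝ) → Ext σ} {p : κ → ℝ} (hf : ExtDifferentiableAt f p) (s : κ)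
    (l : Module.Dual ℂ (Ext σ)) :
    l (pderiv s f p) = fderiv ℝ (fun q => l (f q)) p (Pi.single s 1) := by
  have hd : ∀ j, DifferentiableAt ℝ (fun q => (Module.finBasis ℂ (Ext σ)).repr (f q) j) p :=
    fun j => hf ((Module.finBasis ℂ (Ext σ)).coord j)
  have : (fun q => l (f q)) = fun q => ∑ j, (Module.finBasis ℂ (Ext σ)).repr (f q) j
      * l (Module.finBasis ℂ (Ext σ) j) := by
    funext q
    exact dual_eq_sum l (f q)
  rw [this, fderiv_fun_sum fun j _ => (hd j).mul_const _, pderiv, componentwise, map_sum,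
    sum_apply]
  refine Finset.sum_congr rfl fun j _ => ?_
  rw [map_smul, fderiv_mul_const (hd j)]
  simp [mul_comm]

theorem pderiv_congr {f g : (κ → ℝ) → Ext σ} {p : κ → ℝ} (h : f =ᶠ[𝓝 p] g) (s : κ) :
    pderiv s f p = pderiv s g p := by
  rw [pderiv, pderiv, componentwise, componentwise]
  refine Finset.sum_congr rfl fun j _ => ?_
  rw [Filter.EventuallyEq.fderiv_eq (h.mono fun q hq => ?_)]
  simp only [hq]

theorem ExtDifferentiableAt.linear {f : (κ → ℝ) → Ext σ} {p : κ → ℝ}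
    (hf : ExtDifferentiableAt f p) (T : Ext σ →ₗ[ℂ] Ext τ) :
    ExtDifferentiableAt (fun q => T (f q)) p := fun l => hf (l ∘ₗ T)

theorem pderiv_linear {f : (κ → ℝ) → Ext σ} {p : κ → ℝ} (hf : ExtDifferentiableAt f p)
    (T : Ext σ →ₗ[ℂ] Ext τ) (s : κ) : pderiv s (fun q => T (f q)) p = T (pderiv s f p) :=
  ext_dual fun l => by
    rw [dual_pderiv (hf.linear T), ← LinearMap.comp_apply, dual_pderiv hf]
    rfl

theorem ExtDifferentiableAt.add {f g : (κ → ℝ) → Ext σ} {p : κ → ℝ}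
    (hf : ExtDifferentiableAt f p) (hg : ExtDifferentiableAt g p) :
    ExtDifferentiableAt (f + g) p := fun l => by
  simp only [Pi.add_apply, map_add]
  exact (hf l).fun_add (hg l)

theorem pderiv_add {f g : (κ → ℝ) → Ext σ} {p : κ → ℝ} (hf : ExtDifferentiableAt f p)
    (hg : ExtDifferentiableAt g p) (s : κ) :
    pderiv s (f + g) p = pderiv s f p + pderiv s g p :=
  ext_dual fun l => by
    rw [dual_pderiv (hf.add hg), map_add, dual_pderiv hf, dual_pderiv hg,
      ← add_apply, ← fderiv_add (hf l) (hg l)]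
    congr 2
    funext q
    simp

theorem ExtDifferentiableAt.sum {ι : Type*} {u : Finset ι} {f : ι → (κ → ℝ) → Ext σ} {p : κ → ℝ}
    (hf : ∀ i ∈ u, ExtDifferentiableAt (f i) p) :
    ExtDifferentiableAt (fun q => ∑ i ∈ u, f i q) p := fun l => by
  simp only [map_sum]
  exact DifferentiableAt.fun_sum fun i hi => hf i hi l

theorem pderiv_sum {ι : Type*} {u : Finset ι} {f : ι → (κ → ℝ) → Ext σ} {p : κ → ℝ}
    (hf : ∀ i ∈ u, ExtDifferentiableAt (f i) p) (s : κ) :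
    pderiv s (fun q => ∑ i ∈ u, f i q) p = ∑ i ∈ u, pderiv s (f i) p :=
  ext_dual fun l => by
    rw [dual_pderiv (ExtDifferentiableAt.sum hf), map_sum]
    simp only [map_sum]
    rw [fderiv_fun_sum fun i hi => hf i hi l, sum_apply]
    exact Finset.sum_congr rfl fun i hi => (dual_pderiv (hf i hi) s l).symm

theorem ExtDifferentiableAt.comp {g : (κ' → ℝ) → Ext σ} {φ : (κ → ℝ) → κ' → ℝ} {p : κ → ℝ}
    (hg : ExtDifferentiableAt g (φ p)) (hφ : DifferentiableAt ℝ φ p) :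
    ExtDifferentiableAt (fun q => g (φ q)) p :=
  fun l => (hg l).comp p hφ

theorem pderiv_comp {g : (κ' → ℝ) → Ext σ} {φ : (κ → ℝ) → κ' → ℝ} {p : κ → ℝ}
    {φ' : (κ → ℝ) →L[ℝ] κ' → ℝ} (hg : ExtDifferentiableAt g (φ p)) (hφ : HasFDerivAt φ φ' p)
    (s : κ) :
    pderiv s (fun q => g (φ q)) p
      = ∑ t, ((φ' (Pi.single s 1) t : ℝ) : ℂ) • pderiv t g (φ p) :=
  ext_dual fun l => by
    rw [dual_pderiv (hg.comp hφ.differentiableAt), map_sum]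
    have h := ((hg l).hasFDerivAt.comp p hφ).fderiv
    change fderiv ℝ ((fun q => l (g q)) ∘ φ) p (Pi.single s 1) = _
    rw [h, ContinuousLinearMap.comp_apply]
    conv_lhs => rw [pi_eq_sum_univ' (φ' (Pi.single s 1)), map_sum]
    refine Finset.sum_congr rfl fun t _ => ?_
    rw [map_smul, map_smul, dual_pderiv hg, smul_eq_mul, Complex.real_smul]

theorem SmoothOn.extDifferentiableAt {n : ℕ} {a : (Fin n → ℝ) → Ext σ} {U : Set (Fin n → ℝ)}
    (ha : SmoothOn a U) (hU : IsOpen U) {x : Fin n → ℝ} (hx : x ∈ U) : ExtDifferentiableAt a x :=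
  fun l => ((ha l).contDiffAt (hU.mem_nhds hx)).differentiableAt (by simp)

theorem SmoothOn.congr {n : ℕ} {a c : (Fin n → ℝ) → Ext σ} {U : Set (Fin n → ℝ)}
    (ha : SmoothOn a U) (h : ∀ x ∈ U, c x = a x) : SmoothOn c U :=
  fun l => (ha l).congr fun x hx => by simp only [h x hx]

theorem SmoothOn.linear {n : ℕ} {a : (Fin n → ℝ) → Ext σ} {U : Set (Fin n → ℝ)}
    (ha : SmoothOn a U) (T : Ext σ →ₗ[ℂ] Ext τ) : SmoothOn (fun x => T (a x)) U :=
  fun l => ha (l ∘ₗ T)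

theorem SmoothOn.sum {n : ℕ} {ι : Type*} {u : Finset ι} {a : ι → (Fin n → ℝ) → Ext σ}
    {U : Set (Fin n → ℝ)} (ha : ∀ i ∈ u, SmoothOn (a i) U) :
    SmoothOn (fun x => ∑ i ∈ u, a i x) U := fun l => by
  simp only [map_sum]
  exact ContDiffOn.sum fun i hi => ha i hi l

theorem SmoothOn.pderiv {n : ℕ} {a : (Fin n → ℝ) → Ext σ} {U : Set (Fin n → ℝ)}
    (ha : SmoothOn a U) (hU : IsOpen U) (i : Fin n) : SmoothOn (pderiv i a) U := fun l => by
  have h : ContDiffOn ℝ ∞ (fderiv ℝ fun x => l (a x)) U :=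
    (ha l).fderiv_of_isOpen hU (by simp)
  exact (h.clm_apply contDiffOn_const).congr fun x hx =>
    dual_pderiv (ha.extDifferentiableAt hU hx) i l

theorem pderiv_pderiv_swap {n : ℕ} {a : (Fin n → ℝ) → Ext σ} {U : Set (Fin n → ℝ)}
    (ha : SmoothOn a U) (hU : IsOpen U) {x : Fin n → ℝ} (hx : x ∈ U) (i j : Fin n) :
    pderiv i (pderiv j a) x = pderiv j (pderiv i a) x :=
  ext_dual fun l => by
    have key : ∀ i j : Fin n, l (pderiv i (pderiv j a) x)
        = fderiv ℝ (fderiv ℝ fun y => l (a y)) x (Pi.single i 1) (Pi.single j 1) := by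
      intro i j
      have h : ContDiffOn ℝ ∞ (fderiv ℝ fun x => l (a x)) U :=
        (ha l).fderiv_of_isOpen hU (by simp)
      have hd : DifferentiableAt ℝ (fderiv ℝ fun x => l (a x)) x :=
        (h.contDiffAt (hU.mem_nhds hx)).differentiableAt (by simp)
      rw [dual_pderiv ((ha.pderiv hU j).extDifferentiableAt hU hx)]
      have he : (fun q => l (pderiv j a q))
          =ᶠ[𝓝 x] fun q => fderiv ℝ (fun y => l (a y)) q (Pi.single j 1) :=
        Filter.eventually_of_mem (hU.mem_nhds hx) fun q hq =>
          dual_pderiv (ha.extDifferentiableAt hU hq) j l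
      rw [he.fderiv_eq, fderiv_clm_apply hd (differentiableAt_const _)]
      simp
    rw [key, key]
    have hs : IsSymmSndFDerivAt ℝ (fun y => l (a y)) x :=
      ((ha l).contDiffAt (hU.mem_nhds hx)).isSymmSndFDerivAt (by
        rw [minSmoothness_of_isRCLikeNormedField]; exact WithTop.coe_le_coe.2 le_top)
    exact hs _ _

end Calculus

/-! ### Projections onto the pieces of a bigrading -/

/-- Used to split a smooth section into smooth pieces: the projections commute with every map that
preserves the pieces, in particular with frame changes. Finite dimension leaves only finitely many
nonzero pieces. -/
theorem exists_projections {V ι : Type*} [AddCommGroup V] [Module ℂ V] [FiniteDimensional ℂ V]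
    {K : ι → Submodule ℂ V} (hK : iSupIndep K) (htop : ⨆ i, K i = ⊤) :
    ∃ (u : Finset ι) (π : ι → V →ₗ[ℂ] V), (∀ i x, π i x ∈ K i) ∧
      (∀ x, ∑ i ∈ u, π i x = x) ∧
      ∀ T : V →ₗ[ℂ] V, (∀ i, ∀ x ∈ K i, T x ∈ K i) → ∀ i x, π i (T x) = T (π i x) := by
  classical
  have hint := DirectSum.isInternal_submodule_of_iSupIndep_of_iSup_eq_top hK htop
  let _ := hint.chooseDecomposition
  let e := DirectSum.decomposeLinearEquiv K
  let π : ι → V →ₗ[ℂ] V := fun i => (K i).subtype ∘ₗ DirectSum.component ℂ ι _ i ∘ₗ e.toLinearMap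
  have hπ : ∀ i x, π i x = DirectSum.decompose K x i := fun i x => rfl
  have hfin := WellFoundedGT.finite_ne_bot_of_iSupIndep hK
  refine ⟨hfin.toFinset, π, fun i x => by rw [hπ]; exact Subtype.mem _, fun x => ?_, ?_⟩
  · conv_rhs => rw [← DirectSum.sum_support_decompose K x]
    refine (Finset.sum_subset (fun i hi => ?_) fun i _ hi => ?_).symm
    · rw [Set.Finite.mem_toFinset]
      intro hbot
      rw [DFinsupp.mem_support_iff] at hi
      refine hi (Subtype.ext ?_)
      have := (DirectSum.decompose K x i).2
      exact (Submodule.mem_bot ℂ).1 (hbot.le this)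
    · rw [DFinsupp.notMem_support_iff] at hi
      rw [hπ, hi]
      rfl
  · intro T hT i x
    induction x using DirectSum.Decomposition.inductionOn K with
    | zero => simp
    | @homogeneous j m =>
      rw [hπ, hπ]
      by_cases h : j = i
      · subst h
        rw [DirectSum.decompose_of_mem_same K (hT j _ m.2), DirectSum.decompose_coe,
          DirectSum.of_eq_same]
      · rw [DirectSum.decompose_of_mem_ne K (hT j _ m.2) h, DirectSum.decompose_of_mem_ne K m.2 h,
          map_zero]
    | add x y hx hy => rw [map_add, map_add, hx, hy, map_add, map_add]

/-! ### Jacobians of action coordinates -/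

section Base

variable {n : ℕ} {B : Type*} [TopologicalSpace B] [ChartedSpace (Fin n → ℝ) B]

variable (n B) in
/-- The changes of coordinates of the atlas are locally affine, with linear parts of
determinant `1`. -/
def IsSpecialAffine : Prop :=
  ∀ e e' : atlas (Fin n → ℝ) B, ∀ b ∈ e.1.source ∩ e'.1.source,
    ∃ (A : Matrix (Fin n) (Fin n) ℝ) (c : Fin n → ℝ), A.det = 1 ∧
      ∀ᶠ b' in 𝓝 b, e'.1 b' = A.mulVec (e.1 b') + c

theorem LagrangianTorusBundle.isSpecialAffine {X : Type*} [TopologicalSpace X]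
    (S : LagrangianTorusBundle n B X) : IsSpecialAffine n B := by
  intro e e' b hb
  obtain ⟨A, c, t, h⟩ := S.transition e e' b hb
  refine ⟨(A.1.map (Int.castRingHom ℝ)), c, ?_, h.mono fun b' hb' => ?_⟩
  · have := (Int.castRingHom ℝ).map_det A.1
    rw [A.2, map_one] at this
    exact this.symm
  · funext i
    rw [hb'.1 i]
    simp [Matrix.mulVec, dotProduct]

/-- Multiplication by a real matrix. -/
def mulVecCLM (A : Matrix (Fin n) (Fin n) ℝ) : (Fin n → ℝ) →L[ℝ] (Fin n → ℝ) :=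
  LinearMap.toContinuousLinearMap (Matrix.toLin' A)

@[simp] theorem mulVecCLM_apply (A : Matrix (Fin n) (Fin n) ℝ) (v : Fin n → ℝ) :
    mulVecCLM A v = A.mulVec v := rfl

theorem hasFDerivAt_mulVec_add (A : Matrix (Fin n) (Fin n) ℝ) (c v : Fin n → ℝ) :
    HasFDerivAt (fun v : Fin n → ℝ => A.mulVec v + c) (mulVecCLM A) v :=
  (mulVecCLM A).hasFDerivAt.add_const c

theorem mem_source_chart₀ (b : B) : b ∈ (chart₀ (n := n) b).1.source := mem_chart_source _ _

theorem diffAt_eq {e : atlas (Fin n → ℝ) B} {b : B} (hb : b ∈ e.1.source)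
    {A : Matrix (Fin n) (Fin n) ℝ} {c : Fin n → ℝ}
    (h : ∀ᶠ b' in 𝓝 b, e.1 b' = A.mulVec ((chart₀ (n := n) b).1 b') + c) :
    diffAt e b = mulVecCLM A := by
  have hm : HasMFDerivAt 𝓘(ℝ, Fin n → ℝ) 𝓘(ℝ, Fin n → ℝ) e.1 b
      (mulVecCLM A) := by
    refine ⟨e.1.continuousAt hb, ?_⟩
    have hd := hasFDerivAt_mulVec_add A c (chartAt (Fin n → ℝ) b b)
    suffices key : HasFDerivAt (fun v => e.1 ((chartAt (Fin n → ℝ) b).symm v)) (mulVecCLM A)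
        (chartAt (Fin n → ℝ) b b) from key.hasFDerivWithinAt
    refine hd.congr_of_eventuallyEq ?_
    have hs := (chartAt (Fin n → ℝ) b).continuousAt_symm (mem_chart_target _ b)
    have hs' : Filter.Tendsto (chartAt (Fin n → ℝ) b).symm (𝓝 (chartAt (Fin n → ℝ) b b)) (𝓝 b) := by
      have := hs.tendsto
      rwa [(chartAt (Fin n → ℝ) b).left_inv (mem_chart_source _ b)] at this
    filter_upwards [hs'.eventually h,
      (chartAt (Fin n → ℝ) b).open_target.mem_nhds (mem_chart_target _ b)] with v hv hv'
    refine hv.trans ?_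
    change A.mulVec (chartAt (Fin n → ℝ) b ((chartAt (Fin n → ℝ) b).symm v)) + c = _
    rw [(chartAt (Fin n → ℝ) b).right_inv hv']
  exact hm.mfderiv

theorem jac_eq {e : atlas (Fin n → ℝ) B} {b : B} (hb : b ∈ e.1.source)
    {A : Matrix (Fin n) (Fin n) ℝ} {c : Fin n → ℝ}
    (h : ∀ᶠ b' in 𝓝 b, e.1 b' = A.mulVec ((chart₀ (n := n) b).1 b') + c) : jac e b = A := by
  rw [jac, diffAt_eq hb h]
  exact LinearMap.toMatrix'_toLin' A

theorem jac_chart₀ (b : B) : jac (chart₀ (n := n) b) b = 1 :=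
  jac_eq (c := 0) (mem_source_chart₀ b) (Filter.Eventually.of_forall fun b' => by simp)

theorem diffAt_chart₀ (b : B) :
    diffAt (chart₀ (n := n) b) b = ContinuousLinearMap.id ℝ (Fin n → ℝ) := by
  rw [diffAt_eq (A := 1) (c := 0) (mem_source_chart₀ b)
    (Filter.Eventually.of_forall fun b' => by simp)]
  ext1 v
  simp

theorem IsSpecialAffine.det_jac (hB : IsSpecialAffine n B) {e : atlas (Fin n → ℝ) B} {b : B}
    (hb : b ∈ e.1.source) : (jac e b).det = 1 := by
  obtain ⟨A, c, hA, h⟩ := hB (chart₀ b) e b ⟨mem_source_chart₀ b, hb⟩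
  rw [jac_eq hb h, hA]

/-- Near `b` the same constant matrix relates both the coordinates and the Jacobians, so the change
of frame is locally constant. -/
theorem IsSpecialAffine.exists_transition (hB : IsSpecialAffine n B) (e e' : atlas (Fin n → ℝ) B)
    {b : B} (hb : b ∈ e.1.source) (hb' : b ∈ e'.1.source) :
    ∃ (A : Matrix (Fin n) (Fin n) ℝ) (c : Fin n → ℝ), A.det = 1 ∧
      ∀ᶠ b' in 𝓝 b, e'.1 b' = A.mulVec (e.1 b') + c ∧ jac e' b' = A * jac e b' := by
  obtain ⟨A, c, hA, h⟩ := hB e e' b ⟨hb, hb'⟩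
  refine ⟨A, c, hA, ?_⟩
  filter_upwards [h.eventually_nhds, e.1.open_source.mem_nhds hb,
    e'.1.open_source.mem_nhds hb'] with b' h' he he'
  refine ⟨h'.self_of_nhds, ?_⟩
  -- The preferred chart at `b'` may differ from the one at `b`; its relation to `e` enters both
  -- Jacobians as the same right factor.
  obtain ⟨A₁, c₁, _, h₁⟩ := hB (chart₀ b') e b' ⟨mem_source_chart₀ b', he⟩
  rw [jac_eq he h₁]
  refine jac_eq (c := A.mulVec c₁ + c) he' ?_
  filter_upwards [h', h₁] with x hx hx₁
  rw [hx, hx₁, Matrix.mulVec_add, Matrix.mulVec_mulVec, add_assoc]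

/-! ### Forms on the base with values in a frame bundle -/

variable (T : Matrix (Fin n) (Fin n) ℝ → Ext (Ix n) →ₐ[ℂ] Ext (Ix n))

/-- The expression in the coordinates `e` of a section over `B`. -/
def baseLocal (e : atlas (Fin n → ℝ) B) (f : B → Ext (Ix n)) (r : Fin n → ℝ) : Ext (Ix n) :=
  T (jac e (e.1.symm r)) (f (e.1.symm r))

variable (B) in
/-- The smooth sections over `B`, for the changes of frame `T`. -/
def OmegaBase : Submodule ℂ (B → Ext (Ix n)) where
  carrier := {f | ∀ e : atlas (Fin n → ℝ) B, SmoothOn (baseLocal T e f) e.1.target}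
  add_mem' := by
    intro f g hf hg e l
    simpa [baseLocal] using (hf e l).add (hg e l)
  zero_mem' := fun e l => by simpa [baseLocal] using contDiffOn_const
  smul_mem' := by
    intro c f hf e l
    simpa [baseLocal] using (contDiffOn_const (c := c)).mul (hf e l)

/-- The first order differential operator `∑ M_i ∂/∂r_i`, in the preferred coordinates. -/
def baseOp (M : Fin n → Ext (Ix n) →ₗ[ℂ] Ext (Ix n)) (f : B → Ext (Ix n)) (b : B) : Ext (Ix n) :=
  ∑ i, M i (pderiv i (baseLocal T (chart₀ b) f) ((chart₀ (n := n) b).1 b))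

/-- The changes of frame `T` transform the symbol `M` like the vector fields `∂/∂r_i`. -/
def IsEquivariantSymbol (M : Fin n → Ext (Ix n) →ₗ[ℂ] Ext (Ix n)) : Prop :=
  ∀ A : Matrix (Fin n) (Fin n) ℝ, A.det = 1 → ∀ j x,
    T A (M j x) = ∑ i, ((A⁻¹ j i : ℝ) : ℂ) • M i (T A x)

variable {T}

theorem OmegaBase.extDifferentiableAt {f : B → Ext (Ix n)} (hf : f ∈ OmegaBase B T)
    (e : atlas (Fin n → ℝ) B) {b : B} (hb : b ∈ e.1.source) :
    ExtDifferentiableAt (baseLocal T e f) (e.1 b) :=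
  (hf e).extDifferentiableAt e.1.open_target (e.1.map_source hb)

/-- Coordinate independence of the operator: the frame change is locally constant and passes through
the derivative, the chain rule contributes A, and equivariance of the symbol contributes A⁻¹. -/
theorem frame_baseOp (hB : IsSpecialAffine n B)
    (hT : ∀ A J x, T (A * J) x = T A (T J x))
    {M : Fin n → Ext (Ix n) →ₗ[ℂ] Ext (Ix n)} (hM : IsEquivariantSymbol T M)
    {f : B → Ext (Ix n)} (hf : f ∈ OmegaBase B T) (e : atlas (Fin n → ℝ) B) {b : B}
    (hb : b ∈ e.1.source) :
    T (jac e b) (baseOp T M f b) = ∑ i, M i (pderiv i (baseLocal T e f) (e.1 b)) := by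
  have hb0 := mem_source_chart₀ (n := n) b
  obtain ⟨A, c, hA, h⟩ := hB.exists_transition (chart₀ b) e hb0 hb
  have hJ : jac e b = A := by rw [h.self_of_nhds.2, jac_chart₀, mul_one]
  have hlin := hasFDerivAt_mulVec_add A c ((chart₀ (n := n) b).1 b)
  have heb : A.mulVec ((chart₀ (n := n) b).1 b) + c = e.1 b := h.self_of_nhds.1.symm
  have hs : Filter.Tendsto (chart₀ (n := n) b).1.symm (𝓝 ((chart₀ (n := n) b).1 b)) (𝓝 b) := by
    have := ((chart₀ (n := n) b).1.continuousAt_symm ((chart₀ (n := n) b).1.map_source hb0)).tendsto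
    rwa [(chart₀ (n := n) b).1.left_inv hb0] at this
  have hev : (fun r => (T A).toLinearMap (baseLocal T (chart₀ b) f r))
      =ᶠ[𝓝 ((chart₀ (n := n) b).1 b)] fun r => baseLocal T e f (A.mulVec r + c) := by
    filter_upwards [hs.eventually h, hs.eventually (e.1.open_source.mem_nhds hb),
      (chart₀ (n := n) b).1.open_target.mem_nhds ((chart₀ (n := n) b).1.map_source hb0)]
      with r hr hre hrt
    rw [(chart₀ (n := n) b).1.right_inv hrt] at hr
    simp only [baseLocal, AlgHom.toLinearMap_apply]
    rw [← hr.1, e.1.left_inv hre, hr.2, hT]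
  have hd0 := OmegaBase.extDifferentiableAt hf (chart₀ b) hb0
  have hd := OmegaBase.extDifferentiableAt hf e hb
  have hder : ∀ j, T A (pderiv j (baseLocal T (chart₀ b) f) ((chart₀ (n := n) b).1 b))
      = ∑ i, ((A i j : ℝ) : ℂ) • pderiv i (baseLocal T e f) (e.1 b) := by
    intro j
    have h1 := pderiv_linear hd0 (T A).toLinearMap j
    rw [AlgHom.toLinearMap_apply] at h1
    rw [← h1, pderiv_congr hev]
    rw [← heb] at hd ⊢
    rw [pderiv_comp (φ := fun v => A.mulVec v + c) hd hlin]
    simp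
  rw [hJ, baseOp, map_sum]
  simp only [hM A hA, hder, map_sum, map_smul]
  rw [Finset.sum_comm]
  refine Finset.sum_congr rfl fun i _ => ?_
  have h2 := sum_smul_sum_smul (A⁻¹.transpose) (A.transpose)
    (fun k => M i (pderiv k (baseLocal T e f) (e.1 b))) i
  simp only [Matrix.transpose_apply] at h2
  -- The matrices from the symbol and from the chain rule are contracted over the old index and
  -- cancel.
  rw [h2, ← Matrix.transpose_mul, mul_inv_of_det_eq_one hA, Matrix.transpose_one, sum_smul_one]

theorem baseLocal_baseOp (hB : IsSpecialAffine n B)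
    (hT : ∀ A J x, T (A * J) x = T A (T J x))
    {M : Fin n → Ext (Ix n) →ₗ[ℂ] Ext (Ix n)} (hM : IsEquivariantSymbol T M)
    {f : B → Ext (Ix n)} (hf : f ∈ OmegaBase B T) (e : atlas (Fin n → ℝ) B) {r : Fin n → ℝ}
    (hr : r ∈ e.1.target) :
    baseLocal T e (baseOp T M f) r = ∑ i, M i (pderiv i (baseLocal T e f) r) := by
  rw [baseLocal, frame_baseOp hB hT hM hf e (e.1.map_target hr), e.1.right_inv hr]

theorem baseOp_mem (hB : IsSpecialAffine n B)
    (hT : ∀ A J x, T (A * J) x = T A (T J x))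
    {M : Fin n → Ext (Ix n) →ₗ[ℂ] Ext (Ix n)} (hM : IsEquivariantSymbol T M)
    {f : B → Ext (Ix n)} (hf : f ∈ OmegaBase B T) : baseOp T M f ∈ OmegaBase B T := by
  intro e
  refine SmoothOn.congr (SmoothOn.sum (u := Finset.univ) fun i _ => ?_)
    fun r hr => baseLocal_baseOp hB hT hM hf e hr
  exact ((hf e).pderiv e.1.open_target i).linear (M i)

theorem baseOp_add {M : Fin n → Ext (Ix n) →ₗ[ℂ] Ext (Ix n)} {f g : B → Ext (Ix n)}
    (hf : f ∈ OmegaBase B T) (hg : g ∈ OmegaBase B T) :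
    baseOp T M (f + g) = baseOp T M f + baseOp T M g := by
  funext b
  have hb := mem_source_chart₀ (n := n) b
  rw [Pi.add_apply, baseOp, baseOp, baseOp, ← Finset.sum_add_distrib]
  refine Finset.sum_congr rfl fun i _ => ?_
  rw [← map_add, ← pderiv_add (OmegaBase.extDifferentiableAt hf _ hb)
    (OmegaBase.extDifferentiableAt hg _ hb)]
  congr 2
  funext r
  simp [baseLocal]

theorem baseOp_smul {M : Fin n → Ext (Ix n) →ₗ[ℂ] Ext (Ix n)} (c : ℂ) {f : B → Ext (Ix n)}
    (hf : f ∈ OmegaBase B T) : baseOp T M (c • f) = c • baseOp T M f := by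
  funext b
  rw [Pi.smul_apply, baseOp, baseOp, Finset.smul_sum]
  refine Finset.sum_congr rfl fun i _ => ?_
  rw [← map_smul]
  congr 1
  have := pderiv_linear (OmegaBase.extDifferentiableAt hf _ (mem_source_chart₀ (n := n) b))
    (c • LinearMap.id) i
  simp only [LinearMap.smul_apply, LinearMap.id_apply] at this
  rw [← this]
  congr 1
  funext r
  simp [baseLocal]

/-- Anticommuting symbols give anticommuting operators. -/
theorem baseOp_anticomm (hB : IsSpecialAffine n B)
    (hT : ∀ A J x, T (A * J) x = T A (T J x))
    {M M' : Fin n → Ext (Ix n) →ₗ[ℂ] Ext (Ix n)} (hM : IsEquivariantSymbol T M)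
    (hM' : IsEquivariantSymbol T M') (h : ∀ i j x, M i (M' j x) = -M' j (M i x))
    {f : B → Ext (Ix n)} (hf : f ∈ OmegaBase B T) :
    baseOp T M (baseOp T M' f) + baseOp T M' (baseOp T M f) = 0 := by
  funext b
  have hb := mem_source_chart₀ (n := n) b
  have ht := (chart₀ (n := n) b).1.map_source hb
  have ho := (chart₀ (n := n) b).1.open_target
  have hs := hf (chart₀ b)
  have key : ∀ {N N' : Fin n → Ext (Ix n) →ₗ[ℂ] Ext (Ix n)}, IsEquivariantSymbol T N' →
      baseOp T N (baseOp T N' f) b = ∑ i, ∑ j, N i (N' j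
        (pderiv i (pderiv j (baseLocal T (chart₀ b) f)) ((chart₀ (n := n) b).1 b))) := by
    intro N N' hN'
    rw [baseOp]
    refine Finset.sum_congr rfl fun i _ => ?_
    rw [← map_sum]
    congr 1
    have hd : ∀ j, ExtDifferentiableAt (pderiv j (baseLocal T (chart₀ b) f))
        ((chart₀ (n := n) b).1 b) := fun j => (hs.pderiv ho j).extDifferentiableAt ho ht
    have he : baseLocal T (chart₀ b) (baseOp T N' f) =ᶠ[𝓝 ((chart₀ (n := n) b).1 b)]
        fun r => ∑ j, N' j (pderiv j (baseLocal T (chart₀ b) f) r) :=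
      Filter.eventually_of_mem (ho.mem_nhds ht) fun r hr => baseLocal_baseOp hB hT hN' hf _ hr
    rw [pderiv_congr he, pderiv_sum fun j _ => (hd j).linear (N' j)]
    exact Finset.sum_congr rfl fun j _ => pderiv_linear (hd j) (N' j) i
  -- Both compositions are double sums over second partials. After exchanging the indices in one of
  -- them, terms cancel by symmetry of second derivatives and anticommutation of the symbols.
  rw [Pi.add_apply, key hM', key hM, Finset.sum_comm (f := fun i j => M' i (M j _)),
    ← Finset.sum_add_distrib]
  refine Finset.sum_eq_zero fun i _ => ?_
  rw [← Finset.sum_add_distrib]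
  refine Finset.sum_eq_zero fun j _ => ?_
  rw [h, pderiv_pderiv_swap hs ho ht i j, neg_add_cancel]

/-- The anticommutator of the operator with itself is twice its square. -/
theorem baseOp_sq (hB : IsSpecialAffine n B)
    (hT : ∀ A J x, T (A * J) x = T A (T J x))
    {M : Fin n → Ext (Ix n) →ₗ[ℂ] Ext (Ix n)} (hM : IsEquivariantSymbol T M)
    (h : ∀ i j x, M i (M j x) = -M j (M i x))
    {f : B → Ext (Ix n)} (hf : f ∈ OmegaBase B T) : baseOp T M (baseOp T M f) = 0 := by
  have h2 := baseOp_anticomm hB hT hM hM h hf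
  rw [← two_smul ℂ] at h2
  exact (smul_eq_zero.1 h2).resolve_left two_ne_zero

end Base

/-! ### Transport of double complexes -/

section Transport

variable {V₀ V₁ V₂ : Type*} [AddCommGroup V₀] [Module ℂ V₀] [AddCommGroup V₁] [Module ℂ V₁]
  [AddCommGroup V₂] [Module ℂ V₂] {Ω : Submodule ℂ V₀} {W : ℕ → ℕ → Submodule ℂ V₀}
  {D₁ D₂ : V₀ → V₀}

theorem IsDoubleComplex.piece_le (h : IsDoubleComplex Ω W D₁ D₂) (p q : ℕ) : W p q ≤ Ω := by
  rw [← h.iSup_eq]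
  exact le_iSup (fun pq : ℕ × ℕ => W pq.1 pq.2) (p, q)

theorem IsDoubleComplex.map (h : IsDoubleComplex Ω W D₁ D₂) (hD₁ : ∀ φ ∈ Ω, D₁ φ ∈ Ω)
    (hD₂ : ∀ φ ∈ Ω, D₂ φ ∈ Ω) (j : V₀ →ₗ[ℂ] V₁) (hj : Function.Injective j) {D₁' D₂' : V₁ → V₁}
    (h₁ : ∀ φ ∈ Ω, D₁' (j φ) = j (D₁ φ)) (h₂ : ∀ φ ∈ Ω, D₂' (j φ) = j (D₂ φ)) :
    IsDoubleComplex (Ω.map j) (fun p q => (W p q).map j) D₁' D₂' where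
  indep := LinearMap.iSupIndep_map j hj h.indep
  iSup_eq := by rw [← Submodule.map_iSup, h.iSup_eq]
  add₁ := by
    rintro _ ⟨φ, hφ, rfl⟩ _ ⟨ψ, hψ, rfl⟩
    rw [← map_add, h₁ _ (Ω.add_mem hφ hψ), h₁ _ hφ, h₁ _ hψ, h.add₁ φ hφ ψ hψ, map_add]
  add₂ := by
    rintro _ ⟨φ, hφ, rfl⟩ _ ⟨ψ, hψ, rfl⟩
    rw [← map_add, h₂ _ (Ω.add_mem hφ hψ), h₂ _ hφ, h₂ _ hψ, h.add₂ φ hφ ψ hψ, map_add]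
  smul₁ := by
    rintro c _ ⟨φ, hφ, rfl⟩
    rw [← map_smul, h₁ _ (Ω.smul_mem c hφ), h₁ _ hφ, h.smul₁ c φ hφ, map_smul]
  smul₂ := by
    rintro c _ ⟨φ, hφ, rfl⟩
    rw [← map_smul, h₂ _ (Ω.smul_mem c hφ), h₂ _ hφ, h.smul₂ c φ hφ, map_smul]
  bideg₁ := by
    rintro p q _ ⟨φ, hφ, rfl⟩
    rw [h₁ _ (h.piece_le p q hφ)]
    exact Submodule.mem_map_of_mem (h.bideg₁ p q φ hφ)
  bideg₂ := by
    rintro p q _ ⟨φ, hφ, rfl⟩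
    rw [h₂ _ (h.piece_le p q hφ)]
    exact Submodule.mem_map_of_mem (h.bideg₂ p q φ hφ)
  sq₁ := by
    rintro _ ⟨φ, hφ, rfl⟩
    rw [h₁ _ hφ, h₁ _ (hD₁ _ hφ), h.sq₁ φ hφ, map_zero]
  sq₂ := by
    rintro _ ⟨φ, hφ, rfl⟩
    rw [h₂ _ hφ, h₂ _ (hD₂ _ hφ), h.sq₂ φ hφ, map_zero]
  anticomm := by
    rintro _ ⟨φ, hφ, rfl⟩
    rw [h₁ _ hφ, h₂ _ hφ, h₂ _ (hD₁ _ hφ), h₁ _ (hD₂ _ hφ), ← map_add, h.anticomm φ hφ, map_zero]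

/-- Both complexes are images of one model, and in terms of the model `f` is multiplication by ε. A
nonzero scalar preserves every submodule and commutes with the differentials, so the precise
constant is immaterial. -/
theorem IsDoubleComplex.iso_of_maps (h : IsDoubleComplex Ω W D₁ D₂) (hD₁ : ∀ φ ∈ Ω, D₁ φ ∈ Ω)
    (hD₂ : ∀ φ ∈ Ω, D₂ φ ∈ Ω) (j : V₀ →ₗ[ℂ] V₁) {D₁' D₂' : V₁ → V₁}
    (h₁ : ∀ φ ∈ Ω, D₁' (j φ) = j (D₁ φ)) (h₂ : ∀ φ ∈ Ω, D₂' (j φ) = j (D₂ φ))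
    (k : V₀ →ₗ[ℂ] V₂) (hk : Function.Injective k) {D₁'' D₂'' : V₂ → V₂}
    (h₁' : ∀ φ ∈ Ω, D₁'' (k φ) = k (D₁ φ)) (h₂' : ∀ φ ∈ Ω, D₂'' (k φ) = k (D₂ φ))
    {f : V₁ → V₂} {ε : ℂ} (hε : ε ≠ 0) (hf : ∀ φ ∈ Ω, f (j φ) = ε • k φ) :
    IsDoubleComplexIso (Ω.map j) (fun p q => (W p q).map j) D₁' D₂'
      (Ω.map k) (fun p q => (W p q).map k) D₁'' D₂'' f := by
  have hbij : ∀ U : Submodule ℂ V₀, U ≤ Ω → Set.BijOn f (U.map j) (U.map k) := by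
    intro U hU
    refine ⟨?_, ?_, ?_⟩
    · rintro _ ⟨φ, hφ, rfl⟩
      rw [hf φ (hU hφ)]
      exact Submodule.smul_mem _ _ (Submodule.mem_map_of_mem hφ)
    · rintro _ ⟨φ, hφ, rfl⟩ _ ⟨ψ, hψ, rfl⟩ he
      rw [hf φ (hU hφ), hf ψ (hU hψ)] at he
      rw [hk (smul_right_injective _ hε he)]
    · rintro _ ⟨φ, hφ, rfl⟩
      refine ⟨j (ε⁻¹ • φ), Submodule.mem_map_of_mem (U.smul_mem _ hφ), ?_⟩
      rw [hf _ (hU (U.smul_mem _ hφ)), map_smul, smul_inv_smul₀ hε]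
  refine ⟨?_, ?_, hbij Ω le_rfl, fun p q => hbij _ (h.piece_le p q), ?_, ?_⟩
  · rintro _ ⟨φ, hφ, rfl⟩ _ ⟨ψ, hψ, rfl⟩
    rw [← map_add, hf _ (Ω.add_mem hφ hψ), hf _ hφ, hf _ hψ, map_add, smul_add]
  · rintro c _ ⟨φ, hφ, rfl⟩
    rw [← map_smul, hf _ (Ω.smul_mem c hφ), hf _ hφ, map_smul, smul_comm]
  · rintro _ ⟨φ, hφ, rfl⟩
    rw [h₁ _ hφ, hf _ (hD₁ _ hφ), hf _ hφ, ← map_smul k ε φ, h₁' _ (Ω.smul_mem _ hφ),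
      h.smul₁ _ _ hφ, map_smul]
  · rintro _ ⟨φ, hφ, rfl⟩
    rw [h₂ _ hφ, hf _ (hD₂ _ hφ), hf _ hφ, ← map_smul k ε φ, h₂' _ (Ω.smul_mem _ hφ),
      h.smul₂ _ _ hφ, map_smul]

end Transport

/-! ### The double complexes on the base -/

section BaseComplex

variable {n : ℕ} {B : Type*} [TopologicalSpace B] [ChartedSpace (Fin n → ℝ) B]

/-- The symbol of `∂`. -/
def symDel (i : Fin n) : Ext (Ix n) →ₗ[ℂ] Ext (Ix n) :=
  (-(Complex.I / 2)) • LinearMap.mulLeft ℂ (dz i)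

/-- The symbol of `∂̄`. -/
def symDelBar (i : Fin n) : Ext (Ix n) →ₗ[ℂ] Ext (Ix n) :=
  (Complex.I / 2) • LinearMap.mulLeft ℂ (dzbar i)

/-- The symbol of `d` on `X`. -/
def symD (i : Fin n) : Ext (Ix n) →ₗ[ℂ] Ext (Ix n) := LinearMap.mulLeft ℂ (dr i)

/-- The symbol of `d^Λ` on `X`. -/
def symDLambda (i : Fin n) : Ext (Ix n) →ₗ[ℂ] Ext (Ix n) := contr (Sum.inr i)

theorem symDel_apply (i : Fin n) (x : Ext (Ix n)) :
    symDel i x = (-(Complex.I / 2)) • (dz i * x) := rfl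

theorem symDelBar_apply (i : Fin n) (x : Ext (Ix n)) :
    symDelBar i x = (Complex.I / 2) • (dzbar i * x) := rfl

theorem symD_apply (i : Fin n) (x : Ext (Ix n)) : symD i x = dr i * x := rfl

theorem isEquivariantSymbol_symDel : IsEquivariantSymbol frameMirror (symDel (n := n)) := by
  intro A _ j x
  simp only [symDel_apply, map_smul, map_mul, frameMirror_dz, Finset.sum_mul, Finset.smul_sum,
    smul_mul_assoc]
  simp only [smul_comm (-(Complex.I / 2))]

theorem isEquivariantSymbol_symDelBar : IsEquivariantSymbol frameMirror (symDelBar (n := n)) := by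
  intro A _ j x
  simp only [symDelBar_apply, map_smul, map_mul, frameMirror_dzbar, Finset.sum_mul,
    Finset.smul_sum, smul_mul_assoc]
  simp only [smul_comm (Complex.I / 2)]

theorem mul_mul_swap {a b : Ext (Ix n)} (h : a * b = -(b * a)) (x : Ext (Ix n)) :
    a * (b * x) = -(b * (a * x)) := by
  rw [← mul_assoc, h, neg_mul, mul_assoc]

theorem symDel_symDel (i j : Fin n) (x : Ext (Ix n)) :
    symDel i (symDel j x) = -symDel j (symDel i x) := by
  simp only [symDel_apply, mul_smul_comm]
  rw [mul_mul_swap (dz_mul_dz_swap i j)]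
  module

theorem symDelBar_symDelBar (i j : Fin n) (x : Ext (Ix n)) :
    symDelBar i (symDelBar j x) = -symDelBar j (symDelBar i x) := by
  simp only [symDelBar_apply, mul_smul_comm]
  rw [mul_mul_swap (dzbar_mul_dzbar_swap i j)]
  module

theorem symDel_symDelBar (i j : Fin n) (x : Ext (Ix n)) :
    symDel i (symDelBar j x) = -symDelBar j (symDel i x) := by
  simp only [symDel_apply, symDelBar_apply, mul_smul_comm]
  rw [mul_mul_swap (dz_mul_dzbar_swap i j)]
  module

/-- The factor -𝐢/2 of the symbol meets the sign (-1)^(n+1) of `ftLin_dz_mul`; their product is the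
normalizing constant. -/
theorem ftLin_symDel (i : Fin n) (x : Ext (Ix n)) :
    ftLin n (symDel i x) = ftConst n • symDLambda i (ftLin n x) := by
  rw [symDel_apply, map_smul, ftLin_dz_mul, smul_smul, ftConst, symDLambda]
  congr 1
  rw [pow_succ]
  ring

theorem ftLin_symDelBar (i : Fin n) (x : Ext (Ix n)) :
    ftLin n (symDelBar i x) = ftConst n • symD i (ftLin n x) := by
  rw [symDelBar_apply, map_smul, ftLin_dzbar_mul, smul_smul, ftConst, symD_apply]
  congr 1
  ring

/-- Multiplication by dr_i anticommutes with both contractions in Λ, except that ∂/∂r_i also pairs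
with dr_i. The surviving term identifies the symbol of d^Λ. -/
theorem dr_mul_lefschetz_sub (i : Fin n) (x : Ext (Ix n)) :
    dr i * lefschetz n x - lefschetz n (dr i * x) = contr (Sum.inr i) x := by
  have h : ∀ j, contr (Sum.inl j) (contr (Sum.inr j) (dr i * x))
      = dr i * contr (Sum.inl j) (contr (Sum.inr j) x)
        - (if j = i then (1 : ℂ) else 0) • contr (Sum.inr j) x := by
    intro j
    rw [dr, contr_dx_mul_of_ne (by simp), map_neg, contr_dx_mul]
    simp
  simp only [lefschetz_apply, h, Finset.sum_sub_distrib, ← Finset.mul_sum, sub_sub_cancel]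
  simp

theorem pderiv_mem {σ κ : Type} [Fintype σ] [DecidableEq σ] [Fintype κ] [DecidableEq κ]
    {f : (κ → ℝ) → Ext σ} {p : κ → ℝ} (hf : ExtDifferentiableAt f p) {K : Submodule ℂ (Ext σ)}
    (hK : ∀ q, f q ∈ K) (s : κ) : pderiv s f p ∈ K := by
  -- A linear retraction onto `K` fixes `f` and commutes with differentiation, so it fixes the
  -- derivative too.
  obtain ⟨r, hr⟩ := LinearMap.exists_leftInverse_of_injective K.subtype K.ker_subtype
  have h : (fun q => (K.subtype ∘ₗ r) (f q)) = f := by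
    funext q
    have := LinearMap.congr_fun hr ⟨f q, hK q⟩
    exact congrArg Subtype.val this
  have h1 := pderiv_linear hf (K.subtype ∘ₗ r) s
  rw [h] at h1
  rw [h1]
  exact Subtype.mem _

variable (B) in
/-- The sections over `B` that correspond to `Ω_B^{p,q}(X̌)`. -/
def basePiece (p q : ℕ) : Submodule ℂ (B → Ext (Ix n)) :=
  OmegaBase B frameMirror ⊓ Submodule.pi Set.univ fun _ => pieceMirror n p q

theorem baseOp_mem_pi {M : Fin n → Ext (Ix n) →ₗ[ℂ] Ext (Ix n)} {p q p' q' : ℕ}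
    (hM : ∀ i, ∀ x ∈ pieceMirror n p q, M i x ∈ pieceMirror n p' q') {f : B → Ext (Ix n)}
    (hf : f ∈ basePiece B p q) (b : B) : baseOp frameMirror M f b ∈ pieceMirror n p' q' :=
  Submodule.sum_mem _ fun i _ => hM i _ (pderiv_mem
    (OmegaBase.extDifferentiableAt hf.1 _ (mem_source_chart₀ b))
    (fun _ => frameMirror_mem _ (hf.2 _ trivial)) i)

theorem iSupIndep_pieceMirror : iSupIndep fun pq : ℕ × ℕ => pieceMirror n pq.1 pq.2 :=
  iSupIndep_of_le_eigenspace (scalingMirror n).toLinearMap two_pow_mul_three_pow_injective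
    fun _ _ hx => Module.End.mem_eigenspace_iff.2 (scalingMirror_eq hx)

/-- Projecting a section pointwise keeps it smooth, because in every chart the constant projection
commutes with the frame change. -/
theorem iSup_basePiece :
    ⨆ pq : ℕ × ℕ, basePiece (n := n) B pq.1 pq.2 = OmegaBase B frameMirror := by
  refine le_antisymm (iSup_le fun pq => inf_le_left) fun f hf => ?_
  obtain ⟨u, π, hπ, hsum, hcomm⟩ := exists_projections (iSupIndep_pieceMirror (n := n))
    iSup_pieceMirror
  have hf' : f = ∑ i ∈ u, fun b => π i (f b) := by
    funext b
    rw [Finset.sum_apply, hsum]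
  rw [hf']
  refine Submodule.sum_mem _ fun i _ => ?_
  refine le_iSup (fun pq : ℕ × ℕ => basePiece (n := n) B pq.1 pq.2) i
    ⟨fun e => ?_, fun b _ => hπ i _⟩
  refine ((hf e).linear (π i)).congr fun r _ => ?_
  exact (hcomm (frameMirror (jac e (e.1.symm r))).toLinearMap
    (fun j x hx => frameMirror_mem _ hx) i _).symm

theorem isDoubleComplex_base (hB : IsSpecialAffine n B) :
    IsDoubleComplex (OmegaBase B (frameMirror (n := n))) (basePiece B)
      (baseOp frameMirror symDel) (baseOp frameMirror symDelBar) where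
  indep := by
    -- The scaling operator applied pointwise has the spaces of sections as subspaces of its
    -- eigenspaces, so independence does not need finite dimension.
    refine iSupIndep_of_le_eigenspace ((scalingMirror n).toLinearMap.compLeft B)
      two_pow_mul_three_pow_injective fun pq f hf => Module.End.mem_eigenspace_iff.2 ?_
    funext b
    exact scalingMirror_eq (hf.2 b trivial)
  iSup_eq := iSup_basePiece
  add₁ _ hf _ hg := baseOp_add hf hg
  add₂ _ hf _ hg := baseOp_add hf hg
  smul₁ c _ hf := baseOp_smul c hf
  smul₂ c _ hf := baseOp_smul c hf
  bideg₁ p q f hf := ⟨baseOp_mem hB frameMirror_mul isEquivariantSymbol_symDel hf.1,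
    fun b _ => baseOp_mem_pi (fun i x hx => Submodule.smul_mem _ _ (dz_mul_mem i hx)) hf b⟩
  bideg₂ p q f hf := ⟨baseOp_mem hB frameMirror_mul isEquivariantSymbol_symDelBar hf.1,
    fun b _ => baseOp_mem_pi (fun i x hx => Submodule.smul_mem _ _ (dzbar_mul_mem i hx)) hf b⟩
  sq₁ _ hf := baseOp_sq hB frameMirror_mul isEquivariantSymbol_symDel symDel_symDel hf
  sq₂ _ hf := baseOp_sq hB frameMirror_mul isEquivariantSymbol_symDelBar symDelBar_symDelBar hf
  anticomm _ hf := baseOp_anticomm hB frameMirror_mul isEquivariantSymbol_symDel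
    isEquivariantSymbol_symDelBar symDel_symDelBar hf

/-! ### The transform over the base -/

variable (n B) in
/-- The Fourier-Mukai transform of sections over `B`. -/
def ftBase : (B → Ext (Ix n)) →ₗ[ℂ] (B → Ext (Ix n)) := (ftLin n).compLeft B

theorem ftBase_injective : Function.Injective (ftBase n B) :=
  (ftLin_bijective n).1.comp_left

theorem baseLocal_ftBase (hB : IsSpecialAffine n B) (f : B → Ext (Ix n))
    (e : atlas (Fin n → ℝ) B) {r : Fin n → ℝ} (hr : r ∈ e.1.target) :
    baseLocal frameX e (ftBase n B f) r = ftLin n (baseLocal frameMirror e f r) :=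
  (ftLin_frameMirror (hB.det_jac (e.1.map_target hr)) _).symm

theorem ftBase_mem_iff (hB : IsSpecialAffine n B) (f : B → Ext (Ix n)) :
    ftBase n B f ∈ OmegaBase B frameX ↔ f ∈ OmegaBase B frameMirror := by
  obtain ⟨ε, hε, h⟩ := exists_ftInvLin_ftLin n
  refine ⟨fun hf e => ?_, fun hf e => ?_⟩
  · refine ((hf e).linear (ε⁻¹ • ftInvLin n)).congr fun r hr => ?_
    rw [baseLocal_ftBase hB f e hr, LinearMap.smul_apply, h, inv_smul_smul₀ hε]
  · exact ((hf e).linear (ftLin n)).congr fun r hr => baseLocal_ftBase hB f e hr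

/-- Preimages are chosen point by point; their smoothness is automatic from `ftBase_mem_iff`, since
the inverse transform is constant in local frames. -/
theorem map_ftBase_inf (hB : IsSpecialAffine n B) {K K' : Submodule ℂ (Ext (Ix n))}
    (hK : K.map (ftLin n) = K') :
    (OmegaBase B frameMirror ⊓ Submodule.pi Set.univ fun _ => K).map (ftBase n B)
      = OmegaBase B frameX ⊓ Submodule.pi Set.univ fun _ => K' := by
  ext g
  constructor
  · rintro ⟨f, hf, rfl⟩
    exact ⟨(ftBase_mem_iff hB f).2 hf.1, fun b _ => hK ▸ Submodule.mem_map_of_mem (hf.2 b trivial)⟩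
  · rintro ⟨hg, hg'⟩
    have : ∀ b, ∃ x ∈ K, ftLin n x = g b := fun b => by
      have := hg' b trivial
      rw [← hK] at this
      exact this
    choose f hf hfg using this
    have hfg' : ftBase n B f = g := funext hfg
    exact ⟨f, ⟨(ftBase_mem_iff hB f).1 (hfg' ▸ hg), fun b _ => hf b⟩, hfg'⟩

theorem map_ftBase_basePiece (hB : IsSpecialAffine n B) (p q : ℕ) :
    (basePiece B p q).map (ftBase n B)
      = OmegaBase B frameX ⊓ Submodule.pi Set.univ fun _ => pieceX n p q :=
  map_ftBase_inf hB (map_ftLin_pieceMirror p q)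

theorem map_ftBase_OmegaBase (hB : IsSpecialAffine n B) :
    (OmegaBase B frameMirror).map (ftBase n B) = OmegaBase B frameX := by
  have := map_ftBase_inf (B := B) hB (K := ⊤) (K' := ⊤)
    (by rw [Submodule.map_top]; exact LinearMap.range_eq_top.2 (ftLin_bijective n).2)
  simpa using this

theorem baseOp_ftBase (hB : IsSpecialAffine n B) {M M' : Fin n → Ext (Ix n) →ₗ[ℂ] Ext (Ix n)}
    {c : ℂ} (h : ∀ i x, ftLin n (M i x) = c • M' i (ftLin n x)) {f : B → Ext (Ix n)}
    (hf : f ∈ OmegaBase B frameMirror) :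
    c • baseOp frameX M' (ftBase n B f) = ftBase n B (baseOp frameMirror M f) := by
  funext b
  have hb := mem_source_chart₀ (n := n) b
  have ht := (chart₀ (n := n) b).1.map_source hb
  have ho := (chart₀ (n := n) b).1.open_target
  have he : baseLocal frameX (chart₀ b) (ftBase n B f) =ᶠ[𝓝 ((chart₀ (n := n) b).1 b)]
      fun r => ftLin n (baseLocal frameMirror (chart₀ b) f r) :=
    Filter.eventually_of_mem (ho.mem_nhds ht) fun r hr => baseLocal_ftBase hB f _ hr
  change c • baseOp frameX M' (ftBase n B f) b = ftLin n (baseOp frameMirror M f b)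
  rw [baseOp, baseOp, map_sum, Finset.smul_sum]
  refine Finset.sum_congr rfl fun i _ => ?_
  rw [h, pderiv_congr he, pderiv_linear (OmegaBase.extDifferentiableAt hf _ hb)]

theorem baseLocal_lefschetz (hB : IsSpecialAffine n B) (f : B → Ext (Ix n))
    (e : atlas (Fin n → ℝ) B) {r : Fin n → ℝ} (hr : r ∈ e.1.target) :
    baseLocal frameX e (fun b => lefschetz n (f b)) r = lefschetz n (baseLocal frameX e f r) :=
  (lefschetz_frameX (hB.det_jac (e.1.map_target hr)) _).symm

theorem lefschetz_mem (hB : IsSpecialAffine n B) {f : B → Ext (Ix n)}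
    (hf : f ∈ OmegaBase B frameX) : (fun b => lefschetz n (f b)) ∈ OmegaBase B frameX :=
  fun e => ((hf e).linear (lefschetz n)).congr fun _ hr => baseLocal_lefschetz hB f e hr

theorem baseOp_lefschetz_sub (hB : IsSpecialAffine n B) {f : B → Ext (Ix n)}
    (hf : f ∈ OmegaBase B frameX) (b : B) :
    baseOp frameX symD (fun b => lefschetz n (f b)) b - lefschetz n (baseOp frameX symD f b)
      = baseOp frameX symDLambda f b := by
  have hb := mem_source_chart₀ (n := n) b
  have ht := (chart₀ (n := n) b).1.map_source hb
  have ho := (chart₀ (n := n) b).1.open_target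
  have he : baseLocal frameX (chart₀ b) (fun b => lefschetz n (f b))
      =ᶠ[𝓝 ((chart₀ (n := n) b).1 b)] fun r => lefschetz n (baseLocal frameX (chart₀ b) f r) :=
    Filter.eventually_of_mem (ho.mem_nhds ht) fun r hr => baseLocal_lefschetz hB f _ hr
  rw [baseOp, baseOp, baseOp, map_sum, ← Finset.sum_sub_distrib]
  refine Finset.sum_congr rfl fun i _ => ?_
  rw [pderiv_congr he, pderiv_linear (OmegaBase.extDifferentiableAt hf _ hb), symD_apply,
    symD_apply, dr_mul_lefschetz_sub]
  rfl

end BaseComplex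

/-! ### Pull-back of sections from the base -/

section PullBack

variable {n : ℕ} {B : Type*} {X : Type*} [TopologicalSpace B] [ChartedSpace (Fin n → ℝ) B]
  [TopologicalSpace X]

theorem cubeIntegral_const {σ : Type} [Fintype σ] [DecidableEq σ] (x : Ext σ) :
    cubeIntegral (fun _ : Fin n → ℝ => x) = x := by
  rw [cubeIntegral, componentwise]
  conv_rhs => rw [← (Module.finBasis ℂ (Ext σ)).sum_repr x]
  refine Finset.sum_congr rfl fun j _ => ?_
  rw [MeasureTheory.setIntegral_const, MeasureTheory.measureReal_def, Real.volume_Icc_pi]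
  simp

theorem pderiv_comp_inl {σ : Type} [Fintype σ] [DecidableEq σ] {f : (Ix n → ℝ) → Ext σ}
    {a : (Fin n → ℝ) → Ext σ} {p : Ix n → ℝ} (ha : ExtDifferentiableAt a (p ∘ Sum.inl))
    (h : f =ᶠ[𝓝 p] fun q => a (q ∘ Sum.inl)) (i : Fin n) :
    pderiv (Sum.inl i) f p = pderiv i a (p ∘ Sum.inl) ∧ pderiv (Sum.inr i) f p = 0 := by
  have hφ : HasFDerivAt (fun q : Ix n → ℝ => q ∘ Sum.inl)
      (LinearMap.toContinuousLinearMap (LinearMap.funLeft ℝ ℝ (Sum.inl : Fin n → Ix n))) p :=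
    (LinearMap.toContinuousLinearMap
      (LinearMap.funLeft ℝ ℝ (Sum.inl : Fin n → Ix n))).hasFDerivAt
  have key := pderiv_comp (φ := fun q : Ix n → ℝ => q ∘ Sum.inl) ha hφ
  refine ⟨?_, ?_⟩
  · rw [pderiv_congr h, key, Finset.sum_eq_single i]
    · simp [LinearMap.funLeft_apply]
    · intro j _ hj
      simp [LinearMap.funLeft_apply, hj]
    · simp
  · rw [pderiv_congr h, key]
    simp [LinearMap.funLeft_apply]

/-! #### The mirror -/

variable (n B) in
/-- Pull-back of sections along `X̌ → B`. -/
def pullMirror : (B → Ext (Ix n)) →ₗ[ℂ] (Mirror n B → Ext (Ix n)) :=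
  LinearMap.funLeft ℂ _ mirrorProj

theorem pullMirror_apply (f : B → Ext (Ix n)) (y : Mirror n B) :
    pullMirror n B f y = f (mirrorProj y) := rfl

theorem mirrorProj_surjective : Function.Surjective (mirrorProj : Mirror n B → B) :=
  fun b => ⟨mirrorPt (chart₀ b) b 0, rfl⟩

theorem pullMirror_injective : Function.Injective (pullMirror n B) :=
  LinearMap.funLeft_injective_of_surjective _ _ _ mirrorProj_surjective

theorem exists_mirrorPt (y : Mirror n B) :
    ∃ t, y = mirrorPt (chart₀ (mirrorProj y)) (mirrorProj y) t := by
  obtain ⟨b, v⟩ := y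
  obtain ⟨v, rfl⟩ := QuotientAddGroup.mk_surjective v
  -- In the preferred chart the differential at `b` is the identity, so a tangent vector is its own
  -- coordinate vector.
  refine ⟨v, ?_⟩
  change (⟨b, _⟩ : Mirror n B) = ⟨b, _⟩
  congr 2
  change v = (diffAt (chart₀ b) b).inverse v
  rw [diffAt_chart₀]
  exact (DFunLike.congr_fun ContinuousLinearMap.inverse_id v).symm

/-- Frame changes are injective, so coefficients independent of θ̌ force the form itself to be
constant along fibres. Its values at θ̌ = 0 give the section over `B`. -/
theorem OmegaMirror_eq_map (hB : IsSpecialAffine n B) :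
    OmegaMirror n B = (OmegaBase B frameMirror).map (pullMirror n B) := by
  ext φ
  constructor
  · intro hφ
    have hpull : pullMirror n B (fun b => φ (mirrorPt (chart₀ b) b 0)) = φ := by
      funext y
      obtain ⟨t, ht⟩ := exists_mirrorPt y
      obtain ⟨a, _, ha⟩ := hφ (chart₀ (mirrorProj y))
      have hb := mem_source_chart₀ (n := n) (mirrorProj y)
      conv_rhs => rw [ht]
      refine frameMirror_injective (hB.det_jac hb) ?_
      exact (ha _ hb 0).trans (ha _ hb t).symm
    refine ⟨_, fun e => ?_, hpull⟩
    obtain ⟨a, ha, ha'⟩ := hφ e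
    refine ha.congr fun r hr => ?_
    have h := ha' _ (e.1.map_target hr) 0
    rw [← hpull, e.1.right_inv hr] at h
    exact h
  · rintro ⟨f, hf, rfl⟩ e
    refine ⟨_, hf e, fun b hb t => ?_⟩
    rw [baseLocal, e.1.left_inv hb]
    rfl

theorem map_inf_pi {E : Type*} {pr : E → B} (hpr : Function.Surjective pr)
    (Ω : Submodule ℂ (B → Ext (Ix n))) (K : Submodule ℂ (Ext (Ix n))) :
    (Ω ⊓ Submodule.pi Set.univ fun _ => K).map (LinearMap.funLeft ℂ (Ext (Ix n)) pr)
      = Ω.map (LinearMap.funLeft ℂ (Ext (Ix n)) pr) ⊓ Submodule.pi Set.univ fun _ => K := by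
  ext φ
  constructor
  · rintro ⟨f, hf, rfl⟩
    exact ⟨⟨f, hf.1, rfl⟩, fun x _ => hf.2 (pr x) trivial⟩
  · rintro ⟨⟨f, hf, rfl⟩, h⟩
    refine ⟨f, ⟨hf, fun b _ => ?_⟩, rfl⟩
    obtain ⟨x, rfl⟩ := hpr b
    exact h x trivial

theorem OmegaMirrorPQ_eq_map (hB : IsSpecialAffine n B) :
    OmegaMirrorPQ n B = fun p q => (basePiece B p q).map (pullMirror n B) := by
  funext p q
  rw [OmegaMirrorPQ, OmegaMirror_eq_map hB]
  exact (map_inf_pi mirrorProj_surjective _ _).symm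

theorem pderiv_localMirror {f : B → Ext (Ix n)} (hf : f ∈ OmegaBase B frameMirror)
    (y : Mirror n B) (v : Fin n → ℝ) (i : Fin n) :
    pderiv (Sum.inl i) (localMirror (chart₀ y.1) (pullMirror n B f))
        (Sum.elim ((chart₀ (n := n) y.1).1 y.1) v)
      = pderiv i (baseLocal frameMirror (chart₀ y.1) f) ((chart₀ (n := n) y.1).1 y.1) ∧
    pderiv (Sum.inr i) (localMirror (chart₀ y.1) (pullMirror n B f))
        (Sum.elim ((chart₀ (n := n) y.1).1 y.1) v) = 0 :=
  pderiv_comp_inl (a := baseLocal frameMirror (chart₀ y.1) f)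
    (p := Sum.elim ((chart₀ (n := n) y.1).1 y.1) v)
    (OmegaBase.extDifferentiableAt hf _ (mem_source_chart₀ y.1))
    (Filter.Eventually.of_forall fun _ => rfl) i

theorem del_pullMirror {f : B → Ext (Ix n)} (hf : f ∈ OmegaBase B frameMirror) :
    del (pullMirror n B f) = pullMirror n B (baseOp frameMirror symDel f) := by
  funext y
  rw [del, mirrorOp, dolb, pullMirror_apply, baseOp]
  refine Finset.sum_congr rfl fun i _ => ?_
  obtain ⟨h1, h2⟩ := pderiv_localMirror hf y (mirrorFib (chart₀ y.1) y) i
  rw [h1, h2, symDel_apply, zero_sub, smul_neg, smul_smul, mul_neg, mul_smul_comm, neg_smul,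
    show (2 : ℂ)⁻¹ * Complex.I = Complex.I / 2 by ring]
  rfl

theorem delBar_pullMirror {f : B → Ext (Ix n)} (hf : f ∈ OmegaBase B frameMirror) :
    delBar (pullMirror n B f) = pullMirror n B (baseOp frameMirror symDelBar f) := by
  funext y
  rw [delBar, mirrorOp, dolbBar, pullMirror_apply, baseOp]
  refine Finset.sum_congr rfl fun i _ => ?_
  obtain ⟨h1, h2⟩ := pderiv_localMirror hf y (mirrorFib (chart₀ y.1) y) i
  rw [h1, h2, symDelBar_apply, zero_add, smul_smul, mul_smul_comm,
    show (2 : ℂ)⁻¹ * Complex.I = Complex.I / 2 by ring]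
  rfl

/-! #### The Lagrangian torus bundle -/

namespace LagrangianTorusBundle

variable (S : LagrangianTorusBundle n B X)

/-- Pull-back of sections along `X → B`. -/
def pullBase : (B → Ext (Ix n)) →ₗ[ℂ] (X → Ext (Ix n)) := LinearMap.funLeft ℂ _ S.proj

theorem pullBase_apply (f : B → Ext (Ix n)) (x : X) : S.pullBase f x = f (S.proj x) := rfl

theorem proj_surjective : Function.Surjective S.proj :=
  fun b => ⟨S.pt (chart₀ b) b 0, S.proj_pt _ _ (mem_source_chart₀ b) 0⟩

theorem pullBase_injective : Function.Injective S.pullBase :=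
  LinearMap.funLeft_injective_of_surjective _ _ _ S.proj_surjective

theorem exists_pt (x : X) : ∃ t, x = S.pt (chart₀ (S.proj x)) (S.proj x) t := by
  have hx : x ∈ (S.coord (chart₀ (S.proj x))).source := by
    rw [S.coord_source]
    exact mem_source_chart₀ _
  refine ⟨S.fib (chart₀ (S.proj x)) x, ?_⟩
  rw [pt, ← S.coord_fst _ x hx]
  have h : (fun i => ((S.fib (chart₀ (S.proj x)) x i : ℝ) : UnitAddCircle))
      = (S.coord (chart₀ (S.proj x)) x).2 := by
    funext i
    exact Quotient.out_eq _
  rw [h, (S.coord (chart₀ (S.proj x))).left_inv hx]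

theorem Omega_eq_map : S.Omega = (OmegaBase B frameX).map S.pullBase := by
  have hB := S.isSpecialAffine
  ext φ
  constructor
  · intro hφ
    have hpull : S.pullBase (fun b => φ (S.pt (chart₀ b) b 0)) = φ := by
      funext x
      obtain ⟨t, ht⟩ := S.exists_pt x
      obtain ⟨a, _, ha⟩ := hφ (chart₀ (S.proj x))
      have hb := mem_source_chart₀ (n := n) (S.proj x)
      conv_rhs => rw [ht]
      refine frameX_injective (hB.det_jac hb) ?_
      exact (ha _ hb 0).trans (ha _ hb t).symm
    refine ⟨_, fun e => ?_, hpull⟩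
    obtain ⟨a, ha, ha'⟩ := hφ e
    refine ha.congr fun r hr => ?_
    have h := ha' _ (e.1.map_target hr) 0
    rw [← hpull, e.1.right_inv hr, pullBase_apply, S.proj_pt _ _ (e.1.map_target hr)] at h
    exact h
  · rintro ⟨f, hf, rfl⟩ e
    refine ⟨_, hf e, fun b hb t => ?_⟩
    rw [baseLocal, e.1.left_inv hb, pullBase_apply, S.proj_pt _ _ hb]
    rfl

theorem OmegaPQ_eq_map : S.OmegaPQ
    = fun p q => (OmegaBase B frameX ⊓ Submodule.pi Set.univ fun _ => pieceX n p q).map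
        S.pullBase := by
  funext p q
  have h := map_inf_pi S.proj_surjective (OmegaBase B frameX) (pieceX n p q)
  rw [OmegaPQ, Omega_eq_map]
  refine Eq.trans ?_ h.symm
  split_ifs with hp
  · simp only [pieceX, if_pos hp]
    rfl
  · simp only [pieceX, if_neg hp]
    rw [eq_comm, eq_bot_iff]
    rintro φ ⟨_, hφ⟩
    exact (Submodule.mem_bot ℂ).2 (funext fun x => (Submodule.mem_bot ℂ).1 (hφ x trivial))

theorem d_pullBase {f : B → Ext (Ix n)} (hf : f ∈ OmegaBase B frameX) :
    S.d (S.pullBase f) = S.pullBase (baseOp frameX symD f) := by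
  funext x
  have hb := mem_source_chart₀ (n := n) (S.proj x)
  set e := chart₀ (n := n) (S.proj x) with he
  set p : Ix n → ℝ := Sum.elim (e.1 (S.proj x)) (S.fib e x) with hp
  -- The agreement holds only near `p`: the chart point built from `r` lies over the expected base
  -- point only for `r` in the chart's target.
  have hloc : S.localForm e (S.pullBase f) =ᶠ[𝓝 p] fun q => baseLocal frameX e f (q ∘ Sum.inl) := by
    have hcont : Continuous fun q : Ix n → ℝ => q ∘ (Sum.inl : Fin n → Ix n) := by fun_prop
    have hmem : e.1.target ∈ 𝓝 (p ∘ Sum.inl) := e.1.open_target.mem_nhds (e.1.map_source hb)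
    filter_upwards [hcont.continuousAt.preimage_mem_nhds hmem] with q hq
    rw [localForm, pullBase_apply, S.proj_pt _ _ (e.1.map_target hq)]
    rfl
  have key := pderiv_comp_inl (a := baseLocal frameX e f) (p := p)
    (OmegaBase.extDifferentiableAt hf e hb) hloc
  rw [d, extD, Fintype.sum_sum_type, pullBase_apply, baseOp]
  simp only [← he, ← hp, key, mul_zero, Finset.sum_const_zero, add_zero]
  rfl

theorem twoFormMatrix_symplecticForm (x : X) :
    twoFormMatrix (S.symplecticForm x) = Matrix.J (Fin n) ℂ := by
  have h : ∀ s t : Ix n, ExteriorAlgebra.algebraMapInv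
      (contr t (contr s (∑ i, dth i * dr i : Ext (Ix n))))
      = ∑ i, ((if s = Sum.inr i then (1 : ℂ) else 0) * (if t = Sum.inl i then (1 : ℂ) else 0)
        - (if s = Sum.inl i then (1 : ℂ) else 0) * (if t = Sum.inr i then (1 : ℂ) else 0)) := by
    intro s t
    have hdx : ∀ u v : Ix n,
        contr u (dx v) = (if u = v then (1 : ℂ) else 0) • (1 : Ext (Ix n)) := by
      intro u v
      have := contr_dx_mul u v (1 : Ext (Ix n))
      simpa using this
    rw [map_sum, map_sum, map_sum]
    refine Finset.sum_congr rfl fun i _ => ?_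
    rw [dth, dr, contr_dx_mul, map_sub, map_smul, hdx, hdx, mul_smul_comm, mul_one, map_smul, hdx]
    simp only [map_sub, map_smul, map_one, smul_eq_mul, mul_one]
  ext s t
  rw [twoFormMatrix, Matrix.of_apply, symplecticForm, h]
  rcases s with i | i <;> rcases t with j | j <;>
    simp [Matrix.J, Matrix.fromBlocks, Matrix.one_apply, Finset.sum_ite_eq]

/-- The inverse of the matrix of ω is -J. Its two off-diagonal blocks give equal contributions once
the contractions are reordered, which cancels the factor 1/2. -/
theorem dualLefschetz_apply (φ : X → Ext (Ix n)) (x : X) :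
    S.dualLefschetz φ x = lefschetz n (φ x) := by
  rw [dualLefschetz, twoFormMatrix_symplecticForm, Matrix.J_inv, lefschetz_apply]
  simp only [Fintype.sum_sum_type, Matrix.J, Matrix.neg_apply, Matrix.fromBlocks_apply₁₁,
    Matrix.fromBlocks_apply₁₂, Matrix.fromBlocks_apply₂₁, Matrix.fromBlocks_apply₂₂,
    Matrix.zero_apply, Matrix.one_apply, neg_zero, zero_smul, Finset.sum_const_zero, neg_neg,
    zero_add, add_zero, ite_smul, one_smul, Finset.sum_ite_eq, Finset.mem_univ, if_true, neg_smul]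
  simp only [contr_contr_swap (Sum.inr _) (Sum.inl _)]
  simp only [Finset.sum_neg_distrib, Finset.sum_ite_eq, Finset.mem_univ, if_true, neg_neg]
  rw [← two_smul ℂ, inv_smul_smul₀ two_ne_zero]

theorem dLambda_pullBase {f : B → Ext (Ix n)} (hf : f ∈ OmegaBase B frameX) :
    S.dLambda (S.pullBase f) = S.pullBase (baseOp frameX symDLambda f) := by
  have hB := S.isSpecialAffine
  have h : S.dualLefschetz (S.pullBase f) = S.pullBase fun b => lefschetz n (f b) :=
    funext fun x => S.dualLefschetz_apply _ x
  funext x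
  rw [dLambda, Pi.sub_apply, h, S.d_pullBase (lefschetz_mem hB hf), dualLefschetz_apply,
    S.d_pullBase hf]
  exact baseOp_lefschetz_sub hB hf _

/-- The integrand does not depend on θ̌ and the fundamental cube has volume one, so the fibre
integral is just the algebraic stripping of the dθ̌. -/
theorem FT_pullMirror (f : B → Ext (Ix n)) :
    S.FT (pullMirror n B f) = S.pullBase (ftBase n B f) := by
  funext x
  exact (cubeIntegral_const (stripDual (pullDual (polSwitch (f (S.proj x)))
    * IsNilpotent.exp ((2 * Complex.I)⁻¹ • curvature)))).trans (stripDual_eq _)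

theorem FTinv_pullBase (f : B → Ext (Ix n)) (y : Mirror n B) :
    S.FTinv (S.pullBase f) y = ftInvLin n (f (mirrorProj y)) := by
  have h : (fun t => stripX (pullX (S.pullBase f (S.pt (chart₀ (mirrorProj y)) (mirrorProj y) t))
        * IsNilpotent.exp (-(2 * Complex.I)⁻¹ • curvature)))
      = fun _ => stripX (pullX (f (mirrorProj y))
        * IsNilpotent.exp (-(2 * Complex.I)⁻¹ • curvature)) := by
    funext t
    rw [pullBase_apply, S.proj_pt _ _ (mem_source_chart₀ (mirrorProj y))]
  exact (congrArg polSwitchInv ((congrArg cubeIntegral h).trans (cubeIntegral_const _))).trans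
    (stripX_eq _)

end LagrangianTorusBundle

end PullBack
end SemiFlat

end

/-! ### The theorem: transport of the double complex from the base -/

open SemiFlat in
theorem theorem4p3 {n : ℕ} {B : Type*} {X : Type*} [TopologicalSpace B]
    [ChartedSpace (Fin n → ℝ) B] [TopologicalSpace X]
    (S : SemiFlat.LagrangianTorusBundle n B X) :
    SemiFlat.IsDoubleComplex (SemiFlat.OmegaMirror n B) (SemiFlat.OmegaMirrorPQ n B)
      SemiFlat.del SemiFlat.delBar ∧
    SemiFlat.IsDoubleComplex S.Omega S.OmegaPQ
      (fun φ => SemiFlat.ftConst n • S.dLambda φ) (fun φ => SemiFlat.ftConst n • S.d φ) ∧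
    SemiFlat.IsDoubleComplexIso
      (SemiFlat.OmegaMirror n B) (SemiFlat.OmegaMirrorPQ n B) SemiFlat.del SemiFlat.delBar
      S.Omega S.OmegaPQ
      (fun φ => SemiFlat.ftConst n • S.dLambda φ) (fun φ => SemiFlat.ftConst n • S.d φ)
      S.FT ∧
    SemiFlat.IsDoubleComplexIso
      S.Omega S.OmegaPQ
      (fun φ => SemiFlat.ftConst n • S.dLambda φ) (fun φ => SemiFlat.ftConst n • S.d φ)
      (SemiFlat.OmegaMirror n B) (SemiFlat.OmegaMirrorPQ n B) SemiFlat.del SemiFlat.delBar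
      S.FTinv := by
  have hB := S.isSpecialAffine
  have h := isDoubleComplex_base hB
  have hD₁ : ∀ f ∈ OmegaBase B frameMirror, baseOp frameMirror symDel f
      ∈ OmegaBase B (frameMirror (n := n)) :=
    fun f hf => baseOp_mem hB frameMirror_mul isEquivariantSymbol_symDel hf
  have hD₂ : ∀ f ∈ OmegaBase B frameMirror, baseOp frameMirror symDelBar f
      ∈ OmegaBase B (frameMirror (n := n)) :=
    fun f hf => baseOp_mem hB frameMirror_mul isEquivariantSymbol_symDelBar hf
  have hX₁ : ∀ f ∈ OmegaBase B frameMirror,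
      ftConst n • S.dLambda ((S.pullBase ∘ₗ ftBase n B) f)
        = (S.pullBase ∘ₗ ftBase n B) (baseOp frameMirror symDel f) := fun f hf => by
    rw [LinearMap.comp_apply, LinearMap.comp_apply,
      S.dLambda_pullBase ((ftBase_mem_iff hB f).2 hf), ← map_smul,
      baseOp_ftBase hB ftLin_symDel hf]
  have hX₂ : ∀ f ∈ OmegaBase B frameMirror,
      ftConst n • S.d ((S.pullBase ∘ₗ ftBase n B) f)
        = (S.pullBase ∘ₗ ftBase n B) (baseOp frameMirror symDelBar f) := fun f hf => by
    rw [LinearMap.comp_apply, LinearMap.comp_apply,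
      S.d_pullBase ((ftBase_mem_iff hB f).2 hf), ← map_smul,
      baseOp_ftBase hB ftLin_symDelBar hf]
  have hinj : Function.Injective (S.pullBase ∘ₗ ftBase n B) :=
    S.pullBase_injective.comp ftBase_injective
  have hΩ : S.Omega = (OmegaBase B frameMirror).map (S.pullBase ∘ₗ ftBase n B) := by
    rw [S.Omega_eq_map, ← map_ftBase_OmegaBase hB, Submodule.map_comp]
  have hW : S.OmegaPQ = fun p q => (basePiece B p q).map (S.pullBase ∘ₗ ftBase n B) := by
    rw [S.OmegaPQ_eq_map]
    funext p q
    rw [← map_ftBase_basePiece hB, Submodule.map_comp]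
  obtain ⟨ε, hε, hinv⟩ := exists_ftInvLin_ftLin n
  -- All spaces become images of the complex over `B` made of mirror sections: by pull-back on X̌,
  -- and by the transform followed by pull-back on X.
  rw [hΩ, hW, OmegaMirror_eq_map hB, OmegaMirrorPQ_eq_map hB]
  refine ⟨h.map hD₁ hD₂ _ pullMirror_injective (fun _ => del_pullMirror)
      fun _ => delBar_pullMirror,
    h.map hD₁ hD₂ _ hinj hX₁ hX₂,
    h.iso_of_maps hD₁ hD₂ _ (fun _ => del_pullMirror) (fun _ => delBar_pullMirror) _ hinj hX₁ hX₂
      one_ne_zero fun f _ => ?_,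
    h.iso_of_maps hD₁ hD₂ _ hX₁ hX₂ _ pullMirror_injective (fun _ => del_pullMirror)
      (fun _ => delBar_pullMirror) hε fun f _ => ?_⟩
  -- In this model the transform to X is the identity, so the scalar is 1.
  · rw [one_smul, S.FT_pullMirror]
    rfl
  -- In the other direction the scalar is that of the fibrewise composite of the two transforms.
  · funext y
    rw [LinearMap.comp_apply, S.FTinv_pullBase]
    exact hinv _
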